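/- Let $\phi_1,\phi_2$ be real with $|\phi_2|<1$, $\phi_1+\phi_2<1$, $\phi_2-\phi_1<1$, and let $(z_t)_{t\in\mathbb Z}$ be the (second-order) stationary Gaussian AR(2) process with known mean zero, $$z_t=\phi_1z_{t-1}+\phi_2z_{t-2}+a_t,\qquad a_t\ \text{independent } N(0,\sigma^2),\ \sigma^2>0 .$$ The roots of $\zeta^2-\phi_1\zeta-\phi_2$ may be distinct (real or complex) or equal. From observations $z_1,\dots,z_n$ form the Burg estimators $$\hat\phi_2=1-\frac{CD^2-2ED^2}{CD^2+8F^2G-4FHD},\qquad \hat\phi_1=\frac{2F}{D}\,(1-\hat\phi_2),$$ where $$C=\tfrac1{n-2}\sum_{t=3}^n(z_t^2+z_{t-2}^2),\quad D=\tfrac1{n-1}\sum_{t=2}^n(z_t^2+z_{t-1}^2),\quad E=\tfrac1{n-2}\sum_{t=3}^n z_tz_{t-2},$$ $$F=\tfrac1{n-1}\sum_{t=2}^n z_tz_{t-1},\quad G=\tfrac1{n-2}\sum_{t=3}^n z_{t-1}^2,\quad H=\tfrac1{n-2}\sum_{t=3}^n(z_tz_{t-1}+z_{t-2}z_{t-1}).$$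 Then for all large $n$ both estimators are integrable, and as $n\to\infty$ $$\mathbb E(\hat\phi_1-\phi_1)=-\frac{\phi_1}{n}+o\!\left(\frac1n\right),\qquad \mathbb E(\hat\phi_2-\phi_2)=-\frac{1+3\phi_2}{n}+o\!\left(\frac1n\right).$$ The least-squares estimators, i.e. the minimizers $(b_1,b_2)$ of $\sum_{t=3}^n(z_t-b_1z_{t-1}-b_2z_{t-2})^2$, are also integrable for all large $n$ and have the same biases: $-\phi_1/n+o(1/n)$ and $-(1+3\phi_2)/n+o(1/n)$, respectively. -/

import Mathlib

open MeasureTheory ProbabilityTheory Filter Asymptotics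
open scoped NNReal

noncomputable section

/-- `z` is a stationary Gaussian AR(2) process with known mean zero, parameters `φ₁`, `φ₂` and
innovations `a`: the `a t` are independent `N(0, v)`, `v = σ² > 0`, the recursion
`z t = φ₁ z (t-1) + φ₂ z (t-2) + a t` holds almost surely at every integer time, and `z` is
second-order stationary with mean zero. -/
structure IsStationaryGaussianAR2 {Ω : Type*} [MeasurableSpace Ω] (P : Measure Ω)
    (φ₁ φ₂ : ℝ) (v : ℝ≥0) (z a : ℤ → Ω → ℝ) : Prop where
  variance_pos : 0 < v
  innovation_law : ∀ t, HasLaw (a t) (gaussianReal 0 v) P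
  innovation_indep : iIndepFun a P
  recursion : ∀ t, ∀ᵐ ω ∂P, z t ω = φ₁ * z (t - 1) ω + φ₂ * z (t - 2) ω + a t ω
  memLp : ∀ t, MemLp (z t) 2 P
  mean_zero : ∀ t, ∫ ω, z t ω ∂P = 0
  cov_shift : ∀ t k, covariance (z (t + k)) (z t) P = covariance (z k) (z 0) P

/-! The sample quantities computed from the observations `x 1, …, x n`. -/

def statC (n : ℕ) (x : ℤ → ℝ) : ℝ :=
  1 / ((n : ℝ) - 2) * ∑ t ∈ Finset.Icc (3 : ℤ) n, (x t ^ 2 + x (t - 2) ^ 2)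

def statD (n : ℕ) (x : ℤ → ℝ) : ℝ :=
  1 / ((n : ℝ) - 1) * ∑ t ∈ Finset.Icc (2 : ℤ) n, (x t ^ 2 + x (t - 1) ^ 2)

def statE (n : ℕ) (x : ℤ → ℝ) : ℝ :=
  1 / ((n : ℝ) - 2) * ∑ t ∈ Finset.Icc (3 : ℤ) n, x t * x (t - 2)

def statF (n : ℕ) (x : ℤ → ℝ) : ℝ :=
  1 / ((n : ℝ) - 1) * ∑ t ∈ Finset.Icc (2 : ℤ) n, x t * x (t - 1)

def statG (n : ℕ) (x : ℤ → ℝ) : ℝ :=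
  1 / ((n : ℝ) - 2) * ∑ t ∈ Finset.Icc (3 : ℤ) n, x (t - 1) ^ 2

def statH (n : ℕ) (x : ℤ → ℝ) : ℝ :=
  1 / ((n : ℝ) - 2) * ∑ t ∈ Finset.Icc (3 : ℤ) n, (x t * x (t - 1) + x (t - 2) * x (t - 1))

/-- The Burg estimate of `φ₂` from `x 1, …, x n`. -/
def burgPhi2 (n : ℕ) (x : ℤ → ℝ) : ℝ :=
  1 - (statC n x * statD n x ^ 2 - 2 * statE n x * statD n x ^ 2) /
    (statC n x * statD n x ^ 2 + 8 * statF n x ^ 2 * statG n x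
      - 4 * statF n x * statH n x * statD n x)

/-- The Burg estimate of `φ₁` from `x 1, …, x n`. -/
def burgPhi1 (n : ℕ) (x : ℤ → ℝ) : ℝ :=
  2 * statF n x / statD n x * (1 - burgPhi2 n x)

/-- The sum of squared one-step prediction errors over `t = 3, …, n` (known mean zero). -/
def residualSS (n : ℕ) (x : ℤ → ℝ) (b₁ b₂ : ℝ) : ℝ :=
  ∑ t ∈ Finset.Icc (3 : ℤ) n, (x t - b₁ * x (t - 1) - b₂ * x (t - 2)) ^ 2

/-- `(b₁, b₂)` is a least-squares estimate of `(φ₁, φ₂)` from `x 1, …, x n`. -/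
def IsLeastSquaresAR2 (n : ℕ) (x : ℤ → ℝ) (b₁ b₂ : ℝ) : Prop :=
  ∀ c₁ c₂ : ℝ, residualSS n x b₁ b₂ ≤ residualSS n x c₁ c₂

/-- `E(est n - θ) ≐ β / n`: for all large `n` the estimator is integrable, and its bias equals
`β / n` up to an error `o(1 / n)`. -/
def HasBiasToOrderInv {Ω : Type*} [MeasurableSpace Ω] (P : Measure Ω)
    (est : ℕ → Ω → ℝ) (θ β : ℝ) : Prop :=
  (∀ᶠ n in atTop, Integrable (est n) P) ∧
    (fun n : ℕ => (∫ ω, (est n ω - θ) ∂P) - β / (n : ℝ)) =o[atTop] (fun n : ℕ => 1 / (n : ℝ))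

end

/-! This is the delta method carried to order 1/n; most of the work lies in making it legitimate
under the expectation sign. Let W₀, W₁, W₂ be the averages over t = 3, …, n of z_{t-1}a_t,
z_{t-2}a_t and a_t² − σ² (`basis`). Their summands are martingale differences, so every L^p norm is
O(n^{-1/2}), and n E(W_i W_j) converges to an explicit matrix. Averaging the recursion against
z_{t-1}, z_{t-2} and z_t gives the sample Yule–Walker equations. Averages of equal lag differ only
by end terms, so up to O(1/n) this is a linear system for the lagged averages, and each of them is
its autocovariance plus a linear combination of the W_i plus O(1/n). By stationarity the lagged
averages are moreover exactly unbiased.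

Such an expansion is a "jet": a limit c, a linear part l in the W_i, and the coefficient q of 1/n in
the mean. Jets can be added and multiplied (`IsJet.mul`); a product acquires the covariance of the
two linear parts in its mean. They can also be divided (`IsJet.of_mul_eq`). If XV = U, then X − c =
d⁻¹((U − cV) − (X − c)(V − d)) with V − d = O(n^{-1/2}), so each use of this identity improves the
bound on X − c by n^{-1/2}, and moments of X of polynomial growth are enough to start. The biases
then come out of rational algebra in φ₂ and ρ = φ₁/(1 − φ₂), and the fourth moment of the
innovations drops out.

It remains to find the crude a priori bound. For Burg it is pointwise: |2F/D| ≤ 1 and 0 ≤ 1 − φ̂₂ ≤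
2, both from sums of squares. For least squares one needs negative moments of the Gram determinant.
It dominates the square of each 2 × 2 minor of the design matrix, hence powers of it dominate
products of disjoint minors; the inverse square root of such a product is integrated by removing
innovations one at a time, because E|b + A a_t|^{-1/2} ≤ K|A|^{-1/2} uniformly in b
(`lintegral_prod_minor_lt_top`).

All this presupposes that z_t depends only on a_s with s ≤ t and has bounded moments of all orders
(`past_and_moments`). The stationary process is an L²-bounded solution of two successive first-order
recursions with complex roots in the unit disc, and iterating each recursion backwards gives both
facts. -/

section

/-! ### Orders of magnitude in all L^p at once. -/

variable {Ω : Type*} [MeasurableSpace Ω]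

/-- All `L^p` norms of `X n` are `O(n ^ r)`. -/
def MomentO {Ω : Type*} [MeasurableSpace Ω] (P : Measure Ω) (X : ℕ → Ω → ℝ) (r : ℝ) : Prop :=
  ∀ p : ℕ, 1 ≤ p → ∃ C : ℝ, 0 ≤ C ∧ ∀ᶠ n : ℕ in atTop, AEStronglyMeasurable (X n) P ∧
    eLpNorm (X n) p P ≤ ENNReal.ofReal (C * (n : ℝ) ^ r)

namespace MomentO

variable {Ω : Type*} [MeasurableSpace Ω] {P : Measure Ω} {X Y : ℕ → Ω → ℝ} {r s : ℝ}

theorem mono (h : MomentO P X r) (hrs : r ≤ s) : MomentO P X s := by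
  intro p hp
  obtain ⟨C, hC, h⟩ := h p hp
  refine ⟨C, hC, ?_⟩
  filter_upwards [h, eventually_ge_atTop 1] with n hn h1
  refine ⟨hn.1, hn.2.trans (ENNReal.ofReal_le_ofReal ?_)⟩
  have : (1 : ℝ) ≤ n := by exact_mod_cast h1
  gcongr

theorem congr (h : MomentO P X r) (hXY : ∀ᶠ n in atTop, X n =ᵐ[P] Y n) : MomentO P Y r := by
  intro p hp
  obtain ⟨C, hC, h⟩ := h p hp
  refine ⟨C, hC, ?_⟩
  filter_upwards [h, hXY] with n hn h1
  exact ⟨hn.1.congr h1, by rw [← eLpNorm_congr_ae h1]; exact hn.2⟩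

theorem add (hX : MomentO P X r) (hY : MomentO P Y r) :
    MomentO P (fun n ω => X n ω + Y n ω) r := by
  intro p hp
  obtain ⟨C, hC, hX⟩ := hX p hp
  obtain ⟨D, hD, hY⟩ := hY p hp
  refine ⟨C + D, by positivity, ?_⟩
  filter_upwards [hX, hY] with n hn hm
  refine ⟨hn.1.add hm.1, (eLpNorm_add_le hn.1 hm.1 (by exact_mod_cast hp)).trans ?_⟩
  rw [add_mul, ENNReal.ofReal_add (by positivity) (by positivity)]
  exact add_le_add hn.2 hm.2

theorem seq_mul (hX : MomentO P X r) {c : ℕ → ℝ} {K : ℝ}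
    (hc : ∀ᶠ n : ℕ in atTop, |c n| ≤ K * (n : ℝ) ^ s) :
    MomentO P (fun n ω => c n * X n ω) (r + s) := by
  intro p hp
  obtain ⟨C, hC, hX⟩ := hX p hp
  refine ⟨|K| * C, by positivity, ?_⟩
  filter_upwards [hX, hc, eventually_gt_atTop 0] with n hn hm h0
  refine ⟨hn.1.const_mul _, ?_⟩
  have h0' : (0 : ℝ) < n := by exact_mod_cast h0
  have := eLpNorm_const_smul (c n) (X n) (p : ENNReal) P
  have e : (c n • X n) = fun ω => c n * X n ω := rfl
  rw [e] at this
  rw [this, Real.rpow_add h0', ← ofReal_norm, Real.norm_eq_abs,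
    show |K| * C * ((n : ℝ) ^ r * (n : ℝ) ^ s) = (|K| * (n : ℝ) ^ s) * (C * (n : ℝ) ^ r) by ring,
    ENNReal.ofReal_mul (by positivity)]
  gcongr
  · refine hm.trans ?_
    gcongr
    exact le_abs_self K
  · exact hn.2

theorem const_mul (hX : MomentO P X r) (c : ℝ) : MomentO P (fun n ω => c * X n ω) r := by
  simpa using! hX.seq_mul (c := fun _ => c) (K := |c|) (s := 0) (by simp)

theorem neg (hX : MomentO P X r) : MomentO P (fun n ω => - X n ω) r := by
  simpa using! hX.const_mul (-1)

theorem sub (hX : MomentO P X r) (hY : MomentO P Y r) :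
    MomentO P (fun n ω => X n ω - Y n ω) r := by
  simpa [sub_eq_add_neg] using! hX.add hY.neg

/-- Hölder with exponents 2p and 2p. A product doubles the exponent, which is why the class controls
every p. -/
theorem mul (hX : MomentO P X r) (hY : MomentO P Y s) :
    MomentO P (fun n ω => X n ω * Y n ω) (r + s) := by
  intro p hp
  obtain ⟨C, hC, hX⟩ := hX (2 * p) (by omega)
  obtain ⟨D, hD, hY⟩ := hY (2 * p) (by omega)
  refine ⟨C * D, by positivity, ?_⟩
  filter_upwards [hX, hY, eventually_gt_atTop 0] with n hn hm h0
  have h0' : (0 : ℝ) < n := by exact_mod_cast h0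
  refine ⟨hn.1.mul hm.1, ?_⟩
  have hp0 : (p : ENNReal) ≠ 0 := by simp; omega
  have : ENNReal.HolderTriple ((2 * p : ℕ) : ENNReal) ((2 * p : ℕ) : ENNReal) (p : ENNReal) := by
    constructor
    push_cast
    rw [ENNReal.mul_inv (by simp) (by simp), ← add_mul, ENNReal.inv_two_add_inv_two, one_mul]
  have := eLpNorm_smul_le_mul_eLpNorm (p := ((2 * p : ℕ) : ENNReal)) (q := ((2 * p : ℕ) : ENNReal))
    (r := (p : ENNReal)) hm.1 hn.1
  refine (this.trans (mul_le_mul' hn.2 hm.2)).trans_eq ?_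
  rw [← ENNReal.ofReal_mul (by positivity), Real.rpow_add h0']
  congr 1
  ring

theorem of_bounded (hm : ∀ n, AEStronglyMeasurable (X n) P)
    (h : ∀ p : ℕ, 1 ≤ p → ∃ C : ℝ, ∀ n, eLpNorm (X n) p P ≤ ENNReal.ofReal C) :
    MomentO P X 0 := by
  intro p hp
  obtain ⟨C, hC⟩ := h p hp
  refine ⟨|C|, abs_nonneg _, .of_forall fun n => ⟨hm n, (hC n).trans ?_⟩⟩
  apply ENNReal.ofReal_le_ofReal
  simpa using le_abs_self C

theorem const [IsProbabilityMeasure P] (c : ℝ) : MomentO P (fun _ _ => c) 0 := by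
  refine of_bounded (fun _ => aestronglyMeasurable_const) fun p hp => ⟨|c|, fun n => ?_⟩
  have hp0 : (p : ENNReal) ≠ 0 := by simp; omega
  rw [eLpNorm_const _ hp0 (NeZero.ne P)]
  simp [← ofReal_norm]

theorem of_abs_le [IsProbabilityMeasure P] (hm : ∀ᶠ n in atTop, AEStronglyMeasurable (X n) P) {C : ℝ}
    (h : ∀ᶠ n in atTop, ∀ᵐ ω ∂P, |X n ω| ≤ C) : MomentO P X 0 := by
  intro p hp
  refine ⟨|C|, abs_nonneg _, ?_⟩
  filter_upwards [hm, h] with n hn h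
  refine ⟨hn, ?_⟩
  have hp0 : (p : ENNReal) ≠ 0 := by simp; omega
  have := eLpNorm_mono_ae (p := (p : ENNReal)) (g := fun _ : Ω => C)
    (h.mono fun ω hω => by
      show ‖X n ω‖ ≤ ‖C‖
      exact (le_trans (by simpa using hω) (le_abs_self C)))
  refine this.trans ?_
  rw [eLpNorm_const _ hp0 (NeZero.ne P)]
  simp [← ofReal_norm]

theorem memLp (hX : MomentO P X r) (p : ℕ) (hp : 1 ≤ p) : ∀ᶠ n in atTop, MemLp (X n) p P := by
  obtain ⟨C, -, h⟩ := hX p hp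
  filter_upwards [h] with n hn
  exact ⟨hn.1, hn.2.trans_lt ENNReal.ofReal_lt_top⟩

theorem integrable (hX : MomentO P X r) : ∀ᶠ n in atTop, Integrable (X n) P := by
  filter_upwards [hX.memLp 1 le_rfl] with n hn
  exact memLp_one_iff_integrable.1 (by simpa using hn)

/-- A term of order strictly smaller than 1/n does not affect the coefficient of 1/n in a mean. -/
theorem tendsto_nat_mul_integral (hX : MomentO P X r) (hr : r < -1) :
    Tendsto (fun n : ℕ => (n : ℝ) * ∫ ω, X n ω ∂P) atTop (nhds 0) := by
  obtain ⟨C, hC, h⟩ := hX 1 le_rfl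
  have h1 : Tendsto (fun n : ℕ => C * (n : ℝ) ^ (-(-1 - r))) atTop (nhds 0) := by
    simpa using ((tendsto_rpow_neg_atTop (by linarith : 0 < -1 - r)).comp
      tendsto_natCast_atTop_atTop).const_mul C
  refine squeeze_zero_norm' ?_ h1
  filter_upwards [h, eventually_gt_atTop 0] with n hn h0
  have h0' : (0 : ℝ) < n := by exact_mod_cast h0
  have h2 : ‖∫ ω, X n ω ∂P‖ ≤ C * (n : ℝ) ^ r := by
    refine (ENNReal.ofReal_le_ofReal_iff (by positivity)).1 ?_
    rw [ofReal_norm]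
    refine (enorm_integral_le_lintegral_enorm _).trans ?_
    have := hn.2
    rwa [Nat.cast_one, eLpNorm_one_eq_lintegral_enorm] at this
  rw [norm_mul, Real.norm_natCast, show -(-1 - r) = 1 + r by ring, Real.rpow_add h0', Real.rpow_one]
  calc _ ≤ (n : ℝ) * (C * (n : ℝ) ^ r) := by gcongr
    _ = _ := by ring

theorem finset_sum {ι : Type*} {X : ι → ℕ → Ω → ℝ} (t : Finset ι) [IsProbabilityMeasure P]
    (h : ∀ i ∈ t, MomentO P (X i) r) : MomentO P (fun n ω => ∑ i ∈ t, X i n ω) r := by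
  classical
  induction t using Finset.induction_on with
  | empty =>
    intro p hp
    exact ⟨0, le_rfl, .of_forall fun n => ⟨by simpa using! aestronglyMeasurable_const, by simp⟩⟩
  | insert i t hi ih =>
    simp only [Finset.sum_insert hi]
    exact (h i (by simp)).add (ih fun j hj => h j (by simp [hj]))

end MomentO

/-! ### Calculus of jets. -/

/-- Random sequences `m i` of order `n ^ (-1/2)` with asymptotic second moments `S i j / n`. -/
structure IsJetBasis (P : Measure Ω) (m : Fin 3 → ℕ → Ω → ℝ) (S : Fin 3 → Fin 3 → ℝ) : Prop where
  momentO : ∀ i, MomentO P (m i) (-1 / 2)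
  cov : ∀ i j, Tendsto (fun n : ℕ => (n : ℝ) * ∫ ω, m i n ω * m j n ω ∂P) atTop (nhds (S i j))

/-- `X n` equals `c + ∑ i, l i * m i n` up to order `1 / n`, and its mean is `c + q / n + o(1/n)`. -/
structure IsJet (P : Measure Ω) (m : Fin 3 → ℕ → Ω → ℝ) (X : ℕ → Ω → ℝ) (c : ℝ) (l : Fin 3 → ℝ)
    (q : ℝ) : Prop where
  approx : MomentO P (fun n ω => X n ω - c - ∑ i, l i * m i n ω) (-1)
  bias : Tendsto (fun n : ℕ => (n : ℝ) * (∫ ω, X n ω ∂P - c)) atTop (nhds q)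

/-- The bilinear form with matrix `S`. -/
def jetForm (S : Fin 3 → Fin 3 → ℝ) (l k : Fin 3 → ℝ) : ℝ := ∑ i, ∑ j, l i * k j * S i j

namespace IsJetBasis

variable {P : Measure Ω} [IsProbabilityMeasure P] {m : Fin 3 → ℕ → Ω → ℝ}
  {S : Fin 3 → Fin 3 → ℝ}

theorem momentO_sum (hm : IsJetBasis P m S) (l : Fin 3 → ℝ) :
    MomentO P (fun n ω => ∑ i, l i * m i n ω) (-1 / 2) :=
  MomentO.finset_sum _ fun i _ => (hm.momentO i).const_mul (l i)

omit [IsProbabilityMeasure P] in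
theorem tendsto_integral_sum_mul_sum (hm : IsJetBasis P m S) (l k : Fin 3 → ℝ) :
    Tendsto (fun n : ℕ => (n : ℝ) * ∫ ω, (∑ i, l i * m i n ω) * (∑ j, k j * m j n ω) ∂P) atTop
      (nhds (jetForm S l k)) := by
  have h : Tendsto (fun n : ℕ => ∑ i, ∑ j, l i * k j * ((n : ℝ) * ∫ ω, m i n ω * m j n ω ∂P))
      atTop (nhds (jetForm S l k)) :=
    tendsto_finsetSum _ fun i _ => tendsto_finsetSum _ fun j _ => (hm.cov i j).const_mul _
  have hint : ∀ᶠ n in atTop, ∀ i j, Integrable (fun ω => m i n ω * m j n ω) P :=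
    eventually_all.2 fun i => eventually_all.2 fun j => ((hm.momentO i).mul (hm.momentO j)).integrable
  refine h.congr' ?_
  filter_upwards [hint] with n hn
  have e : ∀ ω, (∑ i, l i * m i n ω) * (∑ j, k j * m j n ω) =
      ∑ i, ∑ j, l i * k j * (m i n ω * m j n ω) := fun ω => by
    rw [Finset.sum_mul_sum]
    exact Finset.sum_congr rfl fun i _ => Finset.sum_congr rfl fun j _ => by ring
  simp_rw [e]
  rw [integral_finsetSum _ fun i _ => integrable_finsetSum _ fun j _ => (hn i j).const_mul _,
    Finset.mul_sum]
  refine Finset.sum_congr rfl fun i _ => ?_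
  rw [integral_finsetSum _ fun j _ => (hn i j).const_mul _, Finset.mul_sum]
  refine Finset.sum_congr rfl fun j _ => ?_
  rw [integral_const_mul]
  ring

/-- Replacing both factors by their linear parts costs O(n^{-1} · n^{-1/2}), which is negligible
after multiplication by n. -/
theorem tendsto_integral_mul (hm : IsJetBasis P m S) {X Y : ℕ → Ω → ℝ} {l k : Fin 3 → ℝ}
    (hX : MomentO P (fun n ω => X n ω - ∑ i, l i * m i n ω) (-1))
    (hY : MomentO P (fun n ω => Y n ω - ∑ i, k i * m i n ω) (-1)) :
    Tendsto (fun n : ℕ => (n : ℝ) * ∫ ω, X n ω * Y n ω ∂P) atTop (nhds (jetForm S l k)) := by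
  have h1 := hm.momentO_sum l
  have h2 := hm.momentO_sum k
  have hR := ((hX.mul ((hY.mono (by norm_num : (-1 : ℝ) ≤ -1 / 2)).add h2)).add
    ((h1.mul hY).mono (by norm_num : (-1 / 2 + -1 : ℝ) ≤ -1 + -1 / 2)))
  have hlim := (hm.tendsto_integral_sum_mul_sum l k).add
    (hR.tendsto_nat_mul_integral (by norm_num))
  rw [add_zero] at hlim
  refine hlim.congr' ?_
  filter_upwards [hR.integrable, (h1.mul h2).integrable] with n hn hn'
  rw [← mul_add, ← integral_add hn' hn]
  congr 2
  ext ω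
  ring

end IsJetBasis

namespace IsJet

variable {P : Measure Ω} [IsProbabilityMeasure P] {m : Fin 3 → ℕ → Ω → ℝ}
  {S : Fin 3 → Fin 3 → ℝ} {X Y U V : ℕ → Ω → ℝ} {c d q r : ℝ} {l k : Fin 3 → ℝ}

theorem momentO_sub (hm : IsJetBasis P m S) (hX : IsJet P m X c l q) :
    MomentO P (fun n ω => X n ω - c) (-1 / 2) := by
  refine ((hX.approx.mono (by norm_num : (-1 : ℝ) ≤ -1 / 2)).add (hm.momentO_sum l)).congr ?_
  refine .of_forall fun n => .of_forall fun ω => ?_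
  ring

theorem momentO (hm : IsJetBasis P m S) (hX : IsJet P m X c l q) : MomentO P X 0 := by
  refine (((hX.momentO_sub hm).mono (by norm_num : (-1 / 2 : ℝ) ≤ 0)).add
    (MomentO.const c)).congr ?_
  refine .of_forall fun n => .of_forall fun ω => ?_
  ring

theorem integrable (hm : IsJetBasis P m S) (hX : IsJet P m X c l q) :
    ∀ᶠ n in atTop, Integrable (X n) P :=
  (hX.momentO hm).integrable

omit [IsProbabilityMeasure P] in
theorem congr (hX : IsJet P m X c l q) (h : ∀ᶠ n in atTop, X n =ᵐ[P] Y n) :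
    IsJet P m Y c l q := by
  refine ⟨hX.approx.congr ?_, hX.bias.congr' ?_⟩
  · filter_upwards [h] with n hn
    filter_upwards [hn] with ω hω
    rw [hω]
  · filter_upwards [h] with n hn
    rw [integral_congr_ae hn]

omit [IsProbabilityMeasure P] in
theorem of_eq (hX : IsJet P m X c l q) (h : c = d) : IsJet P m X d l q :=
  h ▸ hX

theorem add (hm : IsJetBasis P m S) (hX : IsJet P m X c l q) (hY : IsJet P m Y d k r) :
    IsJet P m (fun n ω => X n ω + Y n ω) (c + d) (fun i => l i + k i) (q + r) := by
  constructor
  · refine (hX.approx.add hY.approx).congr (.of_forall fun n => .of_forall fun ω => ?_)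
    simp only [add_mul, Finset.sum_add_distrib]
    ring
  · refine (hX.bias.add hY.bias).congr' ?_
    filter_upwards [hX.integrable hm, hY.integrable hm] with n h1 h2
    rw [integral_add h1 h2]
    ring

omit [IsProbabilityMeasure P] in
theorem const_mul (a : ℝ) (hX : IsJet P m X c l q) :
    IsJet P m (fun n ω => a * X n ω) (a * c) (fun i => a * l i) (a * q) := by
  constructor
  · refine (hX.approx.const_mul a).congr (.of_forall fun n => .of_forall fun ω => ?_)
    simp only [mul_sub, Finset.mul_sum, mul_assoc]
  · refine (hX.bias.const_mul a).congr fun n => ?_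
    rw [integral_const_mul]
    ring

theorem sub (hm : IsJetBasis P m S) (hX : IsJet P m X c l q) (hY : IsJet P m Y d k r) :
    IsJet P m (fun n ω => X n ω - Y n ω) (c - d) (fun i => l i - k i) (q - r) := by
  simpa [sub_eq_add_neg] using! hX.add hm (hY.const_mul (-1))

theorem const (c : ℝ) : IsJet P m (fun _ _ => c) c (fun _ => 0) 0 := by
  constructor
  · refine ((MomentO.const (P := P) 0).seq_mul (c := fun _ => 0) (K := 0) (s := -1)
      (by simp)).mono (by norm_num : (0 + -1 : ℝ) ≤ -1) |>.congr (.of_forall fun n =>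
        .of_forall fun ω => ?_)
    simp
  · simp

/-- Everything follows from XY = cY + dX − cd + (X − c)(Y − d). The last term is O(1/n) and its mean
is read off the two linear parts. -/
theorem mul (hm : IsJetBasis P m S) (hX : IsJet P m X c l q) (hY : IsJet P m Y d k r) :
    IsJet P m (fun n ω => X n ω * Y n ω) (c * d) (fun i => c * k i + d * l i)
      (c * r + d * q + jetForm S l k) := by
  constructor
  · refine (((hX.approx.const_mul d).add (hY.approx.const_mul c)).add
      (((hX.momentO_sub hm).mul (hY.momentO_sub hm)).mono
        (by norm_num : (-1 / 2 + -1 / 2 : ℝ) ≤ -1))).congr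
      (.of_forall fun n => .of_forall fun ω => ?_)
    simp only [add_mul, Finset.sum_add_distrib, mul_assoc, ← Finset.mul_sum]
    ring
  · refine (((hY.bias.const_mul c).add (hX.bias.const_mul d)).add
      (hm.tendsto_integral_mul hX.approx hY.approx)).congr' ?_
    filter_upwards [hX.integrable hm, hY.integrable hm,
      ((hX.momentO_sub hm).mul (hY.momentO_sub hm)).integrable] with n h1 h2 h3
    have : ∀ ω, X n ω * Y n ω = (c * Y n ω + d * X n ω - c * d) + (X n ω - c) * (Y n ω - d) :=
      fun ω => by ring
    simp_rw [this]
    have h4 : Integrable (fun ω => c * Y n ω + d * X n ω) P := (h2.const_mul c).add (h1.const_mul d)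
    have h5 : Integrable (fun ω => c * Y n ω + d * X n ω - c * d) P := h4.sub (integrable_const _)
    rw [integral_add h5 h3, integral_sub h4 (integrable_const _),
      integral_add (h2.const_mul c) (h1.const_mul d), integral_const_mul, integral_const_mul]
    simp
    ring

/-- If `X * V = U` where `V` and `U` are jets and `X` has moments of at most polynomial growth,
then `X` is a jet. -/
theorem of_mul_eq (hm : IsJetBasis P m S) (hU : IsJet P m U (c * d) l q) (hV : IsJet P m V d k r)
    (hd : d ≠ 0) {a : ℝ} (hX : MomentO P X a) (h : ∀ᶠ n in atTop, ∀ᵐ ω ∂P, X n ω * V n ω = U n ω) :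
    IsJet P m X c (fun i => (l i - c * k i) / d)
      ((q - c * r - jetForm S (fun i => (l i - c * k i) / d) k) / d) := by
  have hW := hU.sub hm (hV.const_mul c)
  rw [sub_self] at hW
  have hW0 := hW.momentO_sub hm
  have hδ := hV.momentO_sub hm
  have key : ∀ᶠ n in atTop, ∀ᵐ ω ∂P,
      X n ω - c = d⁻¹ * ((U n ω - c * V n ω - 0) - (X n ω - c) * (V n ω - d)) := by
    filter_upwards [h] with n hn
    filter_upwards [hn] with ω hω
    rw [← hω]
    field_simp
    ring
  -- Bootstrap: as V − d is O(n^{-1/2}), the identity `key` lowers a known exponent b of X − c by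
  -- 1/2, down to the floor −1/2 set by U − cV.
  have hstep : ∀ b : ℝ, MomentO P (fun n ω => X n ω - c) b →
      MomentO P (fun n ω => X n ω - c) (max (-1 / 2) (b - 1 / 2)) := by
    intro b hb
    refine (((hW0.mono (le_max_left _ _)).sub ((hb.mul hδ).mono ?_)).const_mul d⁻¹).congr ?_
    · refine le_trans (le_of_eq (by ring)) (le_max_right _ _)
    · filter_upwards [key] with n hn
      filter_upwards [hn] with ω hω
      exact hω.symm
  have hiter : ∀ j : ℕ, MomentO P (fun n ω => X n ω - c) (max (-1 / 2) (max a 0 - j / 2)) := by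
    intro j
    induction j with
    | zero =>
      refine ((hX.mono (le_max_left a 0)).sub ((MomentO.const c).mono (le_max_right a 0))).mono ?_
      simp
    | succ j ih =>
      refine (hstep _ ih).mono (max_le (le_max_left _ _) ?_)
      rcases le_total (-1 / 2 : ℝ) (max a 0 - j / 2) with h1 | h1
      · rw [max_eq_right h1]
        refine le_trans (le_of_eq ?_) (le_max_right _ _)
        push_cast
        ring
      · rw [max_eq_left h1]
        exact le_trans (by norm_num) (le_max_left _ _)
  -- Starting from the exponent `max a 0` and losing 1/2 each time, this many rounds reach −1/2.
  obtain ⟨j, hj⟩ := exists_nat_ge (2 * max a 0 + 1)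
  have hX' : MomentO P (fun n ω => X n ω - c) (-1 / 2) :=
    (hiter j).mono (max_le le_rfl (by linarith))
  have hprod := (hX'.mul hδ).mono (by norm_num : (-1 / 2 + -1 / 2 : ℝ) ≤ -1)
  have happ : MomentO P (fun n ω => X n ω - c - ∑ i, (l i - c * k i) / d * m i n ω) (-1) := by
    refine ((hW.approx.sub hprod).const_mul d⁻¹).congr ?_
    filter_upwards [key] with n hn
    filter_upwards [hn] with ω hω
    have e : ∑ i, (l i - c * k i) / d * m i n ω = d⁻¹ * ∑ i, (l i - c * k i) * m i n ω := by
      rw [Finset.mul_sum]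
      exact Finset.sum_congr rfl fun i _ => by ring
    rw [e]
    conv_rhs => rw [hω]
    ring
  refine ⟨happ, ?_⟩
  -- The bias comes from taking means in `key`; the product (X − c)(V − d) contributes the
  -- covariance of the linear parts just found.
  have hlim := ((hU.bias.sub (hV.bias.const_mul c)).sub
    (hm.tendsto_integral_mul happ hV.approx)).const_mul d⁻¹
  rw [← div_eq_inv_mul] at hlim
  refine hlim.congr' ?_
  filter_upwards [key, hU.integrable hm, hV.integrable hm, (hX'.mul hδ).integrable,
    hX'.integrable] with n hn h1 h2 h3 h4
  have h5 : Integrable (X n) P := 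
    (h4.add (integrable_const c)).congr (.of_forall fun ω => by simp)
  have e : ∫ ω, X n ω ∂P - c = ∫ ω, (X n ω - c) ∂P := by
    rw [integral_sub h5 (integrable_const _)]; simp
  rw [e, integral_congr_ae hn, integral_const_mul, integral_sub (by
    simpa using! h1.sub (h2.const_mul c)) h3]
  simp only [sub_zero]
  rw [integral_sub h1 (h2.const_mul c), integral_const_mul]
  ring

end IsJet

theorem IsJet.hasBiasToOrderInv {P : Measure Ω} [IsProbabilityMeasure P]
    {m : Fin 3 → ℕ → Ω → ℝ} {S : Fin 3 → Fin 3 → ℝ} {X : ℕ → Ω → ℝ} {c q : ℝ} {l : Fin 3 → ℝ}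
    (hm : IsJetBasis P m S) (hX : IsJet P m X c l q) : HasBiasToOrderInv P X c q := by
  refine ⟨hX.integrable hm, ?_⟩
  rw [isLittleO_iff_tendsto' (by
    filter_upwards [eventually_gt_atTop 0] with n hn h
    have : (0 : ℝ) < n := by exact_mod_cast hn
    simp [this.ne'] at h)]
  have := hX.bias.sub_const q
  rw [sub_self] at this
  refine this.congr' ?_
  filter_upwards [hX.integrable hm, eventually_gt_atTop 0] with n hn h0
  have : (0 : ℝ) < n := by exact_mod_cast h0
  rw [integral_sub hn (integrable_const _)]
  simp
  field_simp

/-! ### Moment bounds for martingale sums. -/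

theorem eLpNorm_le_ofReal_of_integral_pow_le {P : Measure Ω} {X : Ω → ℝ} {p : ℕ} (hp : 1 ≤ p)
    (hX : MemLp X ((2 * p : ℕ) : ENNReal) P) {K : ℝ} (hK : 0 ≤ K)
    (h : ∫ ω, X ω ^ (2 * p) ∂P ≤ K ^ (2 * p)) :
    eLpNorm X ((2 * p : ℕ) : ENNReal) P ≤ ENNReal.ofReal K := by
  rw [hX.eLpNorm_eq_integral_rpow_norm (by simp; omega) (ENNReal.natCast_ne_top _)]
  apply ENNReal.ofReal_le_ofReal
  have e : ∀ ω, ‖X ω‖ ^ ((2 * p : ℕ) : ENNReal).toReal = X ω ^ (2 * p) := fun ω => by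
    rw [ENNReal.toReal_natCast, Real.rpow_natCast, Real.norm_eq_abs]
    exact (even_two_mul p).pow_abs _
  simp_rw [e]
  rw [ENNReal.toReal_natCast]
  refine (Real.rpow_le_rpow (integral_nonneg fun ω => (even_two_mul p).pow_nonneg _) h
    (by positivity)).trans_eq ?_
  exact Real.pow_rpow_inv_natCast hK (by omega)

theorem integral_pow_le_of_eLpNorm_le {P : Measure Ω} {X : Ω → ℝ} {p : ℕ} (hp : 1 ≤ p)
    (hX : AEStronglyMeasurable X P) {K : ℝ} (hK : 0 ≤ K)
    (h : eLpNorm X ((2 * p : ℕ) : ENNReal) P ≤ ENNReal.ofReal K) :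
    ∫ ω, X ω ^ (2 * p) ∂P ≤ K ^ (2 * p) := by
  have hX' : MemLp X ((2 * p : ℕ) : ENNReal) P := ⟨hX, h.trans_lt ENNReal.ofReal_lt_top⟩
  rw [hX'.eLpNorm_eq_integral_rpow_norm (by simp; omega) (ENNReal.natCast_ne_top _)] at h
  have e : ∀ ω, ‖X ω‖ ^ ((2 * p : ℕ) : ENNReal).toReal = X ω ^ (2 * p) := fun ω => by
    rw [ENNReal.toReal_natCast, Real.rpow_natCast, Real.norm_eq_abs]
    exact (even_two_mul p).pow_abs _
  simp_rw [e] at h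
  rw [ENNReal.toReal_natCast, ENNReal.ofReal_le_ofReal_iff hK] at h
  have h0 : 0 ≤ ∫ ω, X ω ^ (2 * p) ∂P := integral_nonneg fun ω => (even_two_mul p).pow_nonneg _
  have h1 := pow_le_pow_left₀ (by positivity) h (2 * p)
  rwa [Real.rpow_inv_natCast_pow h0 (by omega)] at h1

/-- Young's inequality by cases: if d² ≤ η s² the first term suffices, and otherwise s² ≤ η⁻¹ d²
makes the second suffice. -/
theorem pow_two_mul_mul_sq_le {p : ℕ} {η : ℝ} (hη : 0 < η) (s d : ℝ) :
    s ^ (2 * p) * d ^ 2 ≤ η * s ^ (2 * p + 2) + (η⁻¹) ^ p * d ^ (2 * p + 2) := by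
  have e1 : s ^ (2 * p) = (s ^ 2) ^ p := pow_mul ..
  have e2 : d ^ (2 * p) = (d ^ 2) ^ p := pow_mul ..
  rw [pow_add, pow_add, e1, e2]
  have hs := sq_nonneg s
  have hd := sq_nonneg d
  generalize s ^ 2 = a at *
  generalize d ^ 2 = b at *
  rcases le_total b (η * a) with h | h
  · have : a ^ p * b ≤ a ^ p * (η * a) := by gcongr
    have : 0 ≤ (η⁻¹) ^ p * (b ^ p * b) := by positivity
    linarith
  · have h2 : a ≤ η⁻¹ * b := by
      rw [inv_mul_eq_div, le_div_iff₀ hη]; linarith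
    have : a ^ p * b ≤ (η⁻¹ * b) ^ p * b := by gcongr
    rw [mul_pow] at this
    have : 0 ≤ η * (a ^ p * a) := by positivity
    linarith

/-- A second-order Taylor bound. Convexity, with the tangent taken at x = s + d rather than at s,
gives x^m ≤ s^m + m x^{m-1} d. Replacing x^{m-1} by s^{m-1} then costs a Lipschitz term, and the
factor 4^p comes from max(|x|, |s|) ≤ 2 max(|s|, |d|). The term linear in d is kept exact because it
vanishes in expectation. -/
theorem even_pow_add_le (p : ℕ) (s d : ℝ) :
    (s + d) ^ (2 * p + 2) ≤ s ^ (2 * p + 2) + (2 * p + 2) * (s ^ (2 * p + 1) * d) +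
      (2 * p + 2) * (2 * p + 1) * 4 ^ p * (s ^ (2 * p) * d ^ 2 + d ^ (2 * p + 2)) := by
  set x := s + d with hx
  have hconv : x ^ (2 * p + 2) + (2 * p + 2) * x ^ (2 * p + 1) * (s - x) ≤ s ^ (2 * p + 2) := by
    have hc : ConvexOn ℝ Set.univ fun y : ℝ => y ^ (2 * p + 2) := Even.convexOn_pow ⟨p + 1, by ring⟩
    have hd : HasDerivAt (fun y : ℝ => y ^ (2 * p + 2)) ((2 * p + 2) * x ^ (2 * p + 1)) x := by
      have := hasDerivAt_pow (2 * p + 2) x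
      push_cast at this
      simpa using this
    rcases lt_trichotomy x s with h | h | h
    · have := hc.le_slope_of_hasDerivAt (Set.mem_univ x) (Set.mem_univ s) h hd
      rw [slope_def_field, le_div_iff₀ (by linarith)] at this
      linarith
    · simp [h]
    · have := hc.slope_le_of_hasDerivAt (Set.mem_univ s) (Set.mem_univ x) h hd
      rw [slope_def_field, div_le_iff₀ (by linarith)] at this
      linarith
  have hlip : |x ^ (2 * p + 1) - s ^ (2 * p + 1)| ≤
      |d| * (2 * p + 1) * (4 ^ p * (s ^ (2 * p) + d ^ (2 * p))) := by
    have := abs_pow_sub_pow_le x s (2 * p + 1)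
    push_cast at this
    rw [show x - s = d by rw [hx]; ring] at this
    refine this.trans ?_
    gcongr
    have h1 : max |x| |s| ≤ 2 * max |s| |d| := by
      refine max_le ?_ ?_
      · refine (abs_add_le s d).trans ?_
        linarith [le_max_left |s| |d|, le_max_right |s| |d|]
      · have := abs_nonneg s
        linarith [le_max_left |s| |d|]
    have h2 : max |x| |s| ^ (2 * p) ≤ (2 * max |s| |d|) ^ (2 * p) := by gcongr
    refine h2.trans ?_
    rw [mul_pow, pow_mul 2 2 p, show (2 : ℝ) ^ 2 = 4 by norm_num]
    gcongr
    have e1 : |s| ^ (2 * p) = s ^ (2 * p) := (even_two_mul p).pow_abs _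
    have e2 : |d| ^ (2 * p) = d ^ (2 * p) := (even_two_mul p).pow_abs _
    have n1 : 0 ≤ s ^ (2 * p) := (even_two_mul p).pow_nonneg _
    have n2 : 0 ≤ d ^ (2 * p) := (even_two_mul p).pow_nonneg _
    rcases max_cases |s| |d| with ⟨h, -⟩ | ⟨h, -⟩ <;> rw [h] <;> linarith
  have h3 : d * (x ^ (2 * p + 1) - s ^ (2 * p + 1)) ≤
      (2 * p + 1) * 4 ^ p * (s ^ (2 * p) * d ^ 2 + d ^ (2 * p + 2)) := by
    refine (le_abs_self _).trans ?_
    rw [abs_mul]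
    refine (mul_le_mul_of_nonneg_left hlip (abs_nonneg d)).trans_eq ?_
    have := abs_mul_abs_self d
    rw [show (|d| * (|d| * (2 * p + 1) * (4 ^ p * (s ^ (2 * p) + d ^ (2 * p)))) : ℝ) =
      (|d| * |d|) * ((2 * p + 1) * (4 ^ p * (s ^ (2 * p) + d ^ (2 * p)))) by ring, this]
    ring
  have e : s - x = -d := by rw [hx]; ring
  rw [e] at hconv
  have h4 := mul_le_mul_of_nonneg_left h3 (by positivity : (0 : ℝ) ≤ 2 * p + 2)
  linarith

/-- Growth of a sequence with `u (i + 1) ≤ (1 + 1 / (i + 1)) u i + K (i + 1) ^ (p + 1)`. -/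
theorem le_mul_pow_of_rec_le {u : ℕ → ℝ} {K : ℝ} {p : ℕ} (hK : 0 ≤ K) (h0 : u 0 = 0)
    (h : ∀ i : ℕ, u (i + 1) ≤ (1 + 1 / ((i : ℝ) + 1)) * u i + K * ((i : ℝ) + 1) ^ (p + 1)) (n : ℕ) :
    u n ≤ 2 * K * (n : ℝ) ^ (p + 2) := by
  -- As 1 + 1/(i+1) = (i+2)/(i+1), the quotient u n / (n + 1) satisfies a recursion without growth
  -- factor, which can be summed.
  have key : ∀ n : ℕ, u n ≤ ((n : ℝ) + 1) * (K * n * (n : ℝ) ^ p) := by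
    intro n
    induction n with
    | zero => simp [h0]
    | succ i ih =>
      have hi : (0 : ℝ) < (i : ℝ) + 1 := by positivity
      have e : (1 + 1 / ((i : ℝ) + 1)) = ((i : ℝ) + 2) / (i + 1) := by field_simp; ring
      have h1 := h i
      rw [e] at h1
      have h2 : ((i : ℝ) + 2) / (i + 1) * u i ≤ ((i : ℝ) + 2) * (K * i * (i : ℝ) ^ p) := by
        calc _ ≤ ((i : ℝ) + 2) / (i + 1) * (((i : ℝ) + 1) * (K * i * (i : ℝ) ^ p)) := by gcongr
          _ = _ := by field_simp
      have h3 : ((i : ℝ) + 2) * (K * i * (i : ℝ) ^ p) ≤ ((i : ℝ) + 2) * (K * i * ((i : ℝ) + 1) ^ p) := by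
        gcongr; linarith
      have h4 : K * ((i : ℝ) + 1) ^ (p + 1) ≤ ((i : ℝ) + 2) * (K * ((i : ℝ) + 1) ^ p) := by
        have : 0 ≤ K * ((i : ℝ) + 1) ^ p := by positivity
        rw [pow_succ]; nlinarith
      push_cast
      calc u (i + 1) ≤ ((i : ℝ) + 2) * (K * i * ((i : ℝ) + 1) ^ p)
            + ((i : ℝ) + 2) * (K * ((i : ℝ) + 1) ^ p) := by linarith
        _ = _ := by ring
  refine (key n).trans ?_
  rcases Nat.eq_zero_or_pos n with rfl | hn
  · simp
  have : (1 : ℝ) ≤ n := by exact_mod_cast hn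
  have h5 : 0 ≤ K * (n : ℝ) * (n : ℝ) ^ p := by positivity
  calc ((n : ℝ) + 1) * (K * n * (n : ℝ) ^ p) ≤ (2 * n) * (K * n * (n : ℝ) ^ p) := by
        gcongr; linarith
    _ = _ := by ring

section Martingale

variable {P : Measure Ω} [IsProbabilityMeasure P]

theorem memLp_nat_pow {X : Ω → ℝ} (h : ∀ p : ℕ, MemLp X p P) (k p : ℕ) :
    MemLp (fun ω => X ω ^ k) p P := by
  induction k generalizing p with
  | zero => simpa using! memLp_const (1 : ℝ)
  | succ k ih =>
    have : ENNReal.HolderTriple ((2 * p : ℕ) : ENNReal) ((2 * p : ℕ) : ENNReal) (p : ENNReal) := by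
      constructor
      push_cast
      rw [ENNReal.mul_inv (by simp) (by simp), ← add_mul, ENNReal.inv_two_add_inv_two, one_mul]
    simpa [pow_succ] using! (h (2 * p)).mul' (ih (2 * p))

omit [IsProbabilityMeasure P] in
theorem memLp_nat_mul {X Y : Ω → ℝ} (h : ∀ p : ℕ, MemLp X p P) (h' : ∀ p : ℕ, MemLp Y p P)
    (p : ℕ) : MemLp (fun ω => X ω * Y ω) p P := by
  have : ENNReal.HolderTriple ((2 * p : ℕ) : ENNReal) ((2 * p : ℕ) : ENNReal) (p : ENNReal) := by
    constructor
    push_cast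
    rw [ENNReal.mul_inv (by simp) (by simp), ← add_mul, ENNReal.inv_two_add_inv_two, one_mul]
  exact (h' (2 * p)).mul' (h (2 * p))

omit [IsProbabilityMeasure P] in
theorem integrable_of_memLp_nat {X : Ω → ℝ} (h : ∀ p : ℕ, MemLp X p P) : Integrable X P :=
  memLp_one_iff_integrable.1 (by simpa using h 1)

/-- Moments of sums of bounded-moment increments orthogonal to powers of the previous sums. -/
theorem exists_eLpNorm_sum_le {d : ℕ → Ω → ℝ} (hd : ∀ i, ∀ p : ℕ, MemLp (d i) p P)
    (hB : ∀ p : ℕ, ∃ B : ℝ, ∀ i, eLpNorm (d i) p P ≤ ENNReal.ofReal B)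
    (horth : ∀ i k : ℕ, ∫ ω, (∑ j ∈ Finset.range i, d j ω) ^ k * d i ω ∂P = 0)
    (p : ℕ) : ∃ C : ℝ, 0 ≤ C ∧ ∀ n : ℕ,
      eLpNorm (fun ω => ∑ j ∈ Finset.range n, d j ω) p P ≤
        ENNReal.ofReal (C * (n : ℝ) ^ (1 / 2 : ℝ)) := by
  obtain ⟨B, hB⟩ := hB (2 * (p + 2))
  set S : ℕ → Ω → ℝ := fun n ω => ∑ j ∈ Finset.range n, d j ω with hS
  have hSm : ∀ n, ∀ q : ℕ, MemLp (S n) q P := fun n q => memLp_finsetSum _ fun j _ => hd j q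
  set K : ℝ := (2 * (p + 1 : ℕ) + 2) * (2 * (p + 1 : ℕ) + 1) * 4 ^ (p + 1) with hK
  have hKpos : 0 < K := by positivity
  set D : ℝ := |B| ^ (2 * (p + 2)) with hD
  have hD0 : 0 ≤ D := by positivity
  have hdD : ∀ i, ∫ ω, d i ω ^ (2 * (p + 1) + 2) ∂P ≤ D := fun i =>
    integral_pow_le_of_eLpNorm_le (by omega) (hd i 0).1 (abs_nonneg B)
      ((hB i).trans (ENNReal.ofReal_le_ofReal (le_abs_self B)))
  set u : ℕ → ℝ := fun n => ∫ ω, S n ω ^ (2 * (p + 1) + 2) ∂P with hu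
  have hrec : ∀ i : ℕ, u (i + 1) ≤ (1 + 1 / ((i : ℝ) + 1)) * u i +
      (K * (K ^ (p + 1) + 1) * D) * ((i : ℝ) + 1) ^ (p + 1) := by
    intro i
    have hi : (0 : ℝ) < (i : ℝ) + 1 := by positivity
    -- With this η the s-term adds only the fraction 1/(i+1) of the current moment, so the moments
    -- grow polynomially and not exponentially.
    have hη : 0 < (K * ((i : ℝ) + 1))⁻¹ := by positivity
    have hpt : ∀ ω, S (i + 1) ω ^ (2 * (p + 1) + 2) ≤
        ((1 + 1 / ((i : ℝ) + 1)) * S i ω ^ (2 * (p + 1) + 2) +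
        (2 * (p + 1 : ℕ) + 2) * (S i ω ^ (2 * (p + 1) + 1) * d i ω)) +
        (K * ((K * ((i : ℝ) + 1)) ^ (p + 1) + 1)) * d i ω ^ (2 * (p + 1) + 2) := by
      intro ω
      have h1 := even_pow_add_le (p + 1) (S i ω) (d i ω)
      have h2 := mul_le_mul_of_nonneg_left
        (pow_two_mul_mul_sq_le (p := p + 1) hη (S i ω) (d i ω)) hKpos.le
      rw [inv_inv] at h2
      have e : S (i + 1) ω = S i ω + d i ω := Finset.sum_range_succ _ _
      rw [e]
      rw [← hK] at h1
      have e2 : K * ((K * ((i : ℝ) + 1))⁻¹ * S i ω ^ (2 * (p + 1) + 2)) =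
          1 / ((i : ℝ) + 1) * S i ω ^ (2 * (p + 1) + 2) := by
        field_simp
      rw [mul_add K, e2] at h2
      linarith
    have I1 : Integrable (fun ω => S i ω ^ (2 * (p + 1) + 2)) P :=
      integrable_of_memLp_nat fun q => memLp_nat_pow (hSm i) _ q
    have I1' : Integrable (fun ω => S (i + 1) ω ^ (2 * (p + 1) + 2)) P :=
      integrable_of_memLp_nat fun q => memLp_nat_pow (hSm (i + 1)) _ q
    have I2 : Integrable (fun ω => S i ω ^ (2 * (p + 1) + 1) * d i ω) P :=
      integrable_of_memLp_nat fun q => memLp_nat_mul (fun q => memLp_nat_pow (hSm i) _ q) (hd i) q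
    have I3 : Integrable (fun ω => d i ω ^ (2 * (p + 1) + 2)) P :=
      integrable_of_memLp_nat fun q => memLp_nat_pow (hd i) _ q
    have I12 : Integrable (fun ω => (1 + 1 / ((i : ℝ) + 1)) * S i ω ^ (2 * (p + 1) + 2) +
        (2 * (p + 1 : ℕ) + 2) * (S i ω ^ (2 * (p + 1) + 1) * d i ω)) P :=
      (I1.const_mul _).add (I2.const_mul _)
    have h1 := integral_mono I1' (I12.add (I3.const_mul _)) hpt
    simp only [Pi.add_apply] at h1
    rw [integral_add I12 (I3.const_mul _), integral_add (I1.const_mul _) (I2.const_mul _),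
      integral_const_mul, integral_const_mul, integral_const_mul, horth i, mul_zero, add_zero] at h1
    refine h1.trans (add_le_add le_rfl ?_)
    have h2 : (1 : ℝ) ≤ ((i : ℝ) + 1) ^ (p + 1) := one_le_pow₀ (by linarith [Nat.cast_nonneg (α := ℝ) i])
    calc _ ≤ (K * ((K * ((i : ℝ) + 1)) ^ (p + 1) + 1)) * D := by
          gcongr
          exact hdD i
      _ ≤ (K * ((K * ((i : ℝ) + 1)) ^ (p + 1) + ((i : ℝ) + 1) ^ (p + 1))) * D := by gcongr
      _ = _ := by rw [mul_pow]; ring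
  have hu0 : u 0 = 0 := by simp [hu, hS]
  have hun := le_mul_pow_of_rec_le (u := u) (by positivity) hu0 hrec
  set K' : ℝ := 2 * (K * (K ^ (p + 1) + 1) * D) with hK'
  have hK'0 : 0 ≤ K' := by positivity
  refine ⟨1 + K', by positivity, fun n => ?_⟩
  have hn : (0 : ℝ) ≤ n := Nat.cast_nonneg n
  have h3 : eLpNorm (S n) ((2 * (p + 2) : ℕ) : ENNReal) P ≤
      ENNReal.ofReal ((1 + K') * (n : ℝ) ^ (1 / 2 : ℝ)) := by
    refine eLpNorm_le_ofReal_of_integral_pow_le (by omega) (hSm n _) (by positivity) ?_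
    have : ((n : ℝ) ^ (1 / 2 : ℝ)) ^ (2 * (p + 2)) = (n : ℝ) ^ (p + 2) := by
      rw [← Real.sqrt_eq_rpow, pow_mul, Real.sq_sqrt hn]
    rw [mul_pow, this]
    refine (hun n).trans ?_
    gcongr
    calc K' ≤ 1 + K' := by linarith
      _ ≤ (1 + K') ^ (2 * (p + 2)) := le_self_pow₀ (by linarith) (by omega)
  refine (eLpNorm_le_eLpNorm_of_exponent_le ?_ (hSm n 0).1).trans h3
  exact_mod_cast (by omega : p ≤ 2 * (p + 2))

end Martingale

/-! ### Families with uniformly bounded moments. -/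

/-- A family whose `L^p` norms are bounded, for every `p`. -/
structure UnifMoments {ι : Type*} (P : Measure Ω) (f : ι → Ω → ℝ) : Prop where
  aesm : ∀ i, AEStronglyMeasurable (f i) P
  bdd : ∀ p : ℕ, ∃ B : ℝ, 0 ≤ B ∧ ∀ i, eLpNorm (f i) p P ≤ ENNReal.ofReal B

namespace UnifMoments

variable {ι κ : Type*} {P : Measure Ω} {f g : ι → Ω → ℝ}

theorem memLp (hf : UnifMoments P f) (i : ι) (p : ℕ) : MemLp (f i) p P := by
  obtain ⟨B, -, h⟩ := hf.bdd p
  exact ⟨hf.aesm i, (h i).trans_lt ENNReal.ofReal_lt_top⟩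

theorem integrable (hf : UnifMoments P f) (i : ι) : Integrable (f i) P :=
  integrable_of_memLp_nat (hf.memLp i)

theorem comp (hf : UnifMoments P f) (e : κ → ι) : UnifMoments P (fun k => f (e k)) :=
  ⟨fun _ => hf.aesm _, fun p => (hf.bdd p).imp fun _ h => ⟨h.1, fun _ => h.2 _⟩⟩

theorem mul (hf : UnifMoments P f) (hg : UnifMoments P g) :
    UnifMoments P (fun i ω => f i ω * g i ω) := by
  refine ⟨fun i => (hf.aesm i).mul (hg.aesm i), fun p => ?_⟩
  obtain ⟨B, hB, hf'⟩ := hf.bdd (2 * p)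
  obtain ⟨C, hC, hg'⟩ := hg.bdd (2 * p)
  refine ⟨B * C, by positivity, fun i => ?_⟩
  have : ENNReal.HolderTriple ((2 * p : ℕ) : ENNReal) ((2 * p : ℕ) : ENNReal) (p : ENNReal) := by
    constructor
    push_cast
    rw [ENNReal.mul_inv (by simp) (by simp), ← add_mul, ENNReal.inv_two_add_inv_two, one_mul]
  have := eLpNorm_smul_le_mul_eLpNorm (p := ((2 * p : ℕ) : ENNReal)) (q := ((2 * p : ℕ) : ENNReal))
    (r := (p : ENNReal)) (hg.aesm i) (hf.aesm i)
  rw [ENNReal.ofReal_mul hB]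
  exact this.trans (mul_le_mul' (hf' i) (hg' i))

theorem const_mul (hf : UnifMoments P f) (c : ℝ) : UnifMoments P (fun i ω => c * f i ω) := by
  refine ⟨fun i => (hf.aesm i).const_mul c, fun p => ?_⟩
  obtain ⟨B, hB, hf'⟩ := hf.bdd p
  refine ⟨|c| * B, by positivity, fun i => ?_⟩
  have := eLpNorm_const_smul c (f i) (p : ENNReal) P
  have e : (c • f i) = fun ω => c * f i ω := rfl
  rw [e] at this
  rw [this, ENNReal.ofReal_mul (abs_nonneg c), ← ofReal_norm, Real.norm_eq_abs]
  gcongr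
  exact hf' i

theorem const [IsProbabilityMeasure P] (c : ℝ) : UnifMoments P (fun (_ : ι) (_ : Ω) => c) := by
  refine ⟨fun i => aestronglyMeasurable_const, fun p => ⟨|c|, abs_nonneg c, fun i => ?_⟩⟩
  rcases Nat.eq_zero_or_pos p with rfl | hp
  · simp
  have hp0 : (p : ENNReal) ≠ 0 := by simp; omega
  rw [eLpNorm_const _ hp0 (NeZero.ne P)]
  simp [← ofReal_norm]

theorem add [IsProbabilityMeasure P] (hf : UnifMoments P f) (hg : UnifMoments P g) :
    UnifMoments P (fun i ω => f i ω + g i ω) := by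
  refine ⟨fun i => (hf.aesm i).add (hg.aesm i), fun p => ?_⟩
  obtain ⟨B, hB, hf'⟩ := hf.bdd (p + 1)
  obtain ⟨C, hC, hg'⟩ := hg.bdd (p + 1)
  refine ⟨B + C, by positivity, fun i => ?_⟩
  rw [ENNReal.ofReal_add hB hC]
  refine (eLpNorm_le_eLpNorm_of_exponent_le (q := ((p + 1 : ℕ) : ENNReal))
    (by exact_mod_cast Nat.le_succ p) ((hf.aesm i).add (hg.aesm i))).trans ?_
  exact (eLpNorm_add_le (hf.aesm i) (hg.aesm i) (by exact_mod_cast Nat.succ_pos p)).trans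
    (add_le_add (hf' i) (hg' i))

theorem sub [IsProbabilityMeasure P] (hf : UnifMoments P f) (hg : UnifMoments P g) :
    UnifMoments P (fun i ω => f i ω - g i ω) := by
  simpa [sub_eq_add_neg] using! hf.add (hg.const_mul (-1))

theorem momentO (hf : UnifMoments P f) (e : ℕ → ι) : MomentO P (fun n => f (e n)) 0 :=
  MomentO.of_bounded (fun _ => hf.aesm _) fun p _ => (hf.bdd p).imp fun _ h _ => h.2 _

end UnifMoments

/-! ### The filtration of the innovations and adapted increments. -/

/-- The σ-algebra generated by `a s`, `s ≤ t`. -/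
abbrev pastSigma (a : ℤ → Ω → ℝ) (t : ℤ) : MeasurableSpace Ω :=
  ⨆ s ∈ Set.Iic t, MeasurableSpace.comap (a s) inferInstance

omit [MeasurableSpace Ω] in
theorem pastSigma_mono (a : ℤ → Ω → ℝ) {s t : ℤ} (h : s ≤ t) : pastSigma a s ≤ pastSigma a t :=
  biSup_mono fun _ hi => le_trans (Set.mem_Iic.1 hi) h

theorem pastSigma_le {a : ℤ → Ω → ℝ} (ha : ∀ t, Measurable (a t)) (t : ℤ) :
    pastSigma a t ≤ ‹MeasurableSpace Ω› :=
  iSup₂_le fun s _ => (ha s).comap_le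

theorem aestronglyMeasurable_pastSigma (P : Measure Ω) (a : ℤ → Ω → ℝ) (t : ℤ) :
    AEStronglyMeasurable[pastSigma a t] (a t) P := by
  have h : Measurable[pastSigma a t] (a t) := by
    refine Measurable.mono (comap_measurable (a t)) ?_ le_rfl
    exact le_iSup₂_of_le t (Set.mem_Iic.2 le_rfl) le_rfl
  exact h.stronglyMeasurable.aestronglyMeasurable

theorem indepFun_of_pastSigma {β : Type*} [TopologicalSpace β] [TopologicalSpace.PseudoMetrizableSpace β]
    [MeasurableSpace β] [BorelSpace β] {P : Measure Ω} {a : ℤ → Ω → ℝ}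
    (ha : ∀ t, Measurable (a t)) (hind : iIndepFun a P) {s t : ℤ} (hst : s < t) {Y : Ω → β}
    (hY : AEStronglyMeasurable[pastSigma a s] Y P) : IndepFun Y (a t) P := by
  have h := indep_iSup_of_disjoint (fun i => (ha i).comap_le) hind
    (S := Set.Iic s) (T := {t}) (by simpa using hst)
  rw [iSup_singleton] at h
  obtain ⟨Y', hY', he⟩ := hY
  have h' : IndepFun Y' (a t) P := by
    rw [IndepFun_iff_Indep]
    exact indep_of_indep_of_le_left h hY'.measurable.comap_le
  exact h'.congr he.symm .rfl

theorem AEStronglyMeasurable.pastSigma_mono {β : Type*} [TopologicalSpace β] {P : Measure Ω}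
    {a : ℤ → Ω → ℝ} {s t : ℤ} (hst : s ≤ t) {Y : Ω → β}
    (hY : AEStronglyMeasurable[pastSigma a s] Y P) : AEStronglyMeasurable[pastSigma a t] Y P := by
  obtain ⟨Y', hY', he⟩ := hY
  exact ⟨Y', hY'.mono (_root_.pastSigma_mono a hst), he⟩

/-- Increments adapted to `a` and orthogonal to the past. -/
structure IsIncrement (P : Measure Ω) (a : ℤ → Ω → ℝ) (d : ℕ → Ω → ℝ) : Prop where
  past : ∀ i : ℕ, AEStronglyMeasurable[pastSigma a (i + 3)] (d i) P
  moments : UnifMoments P d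
  orth : ∀ (i : ℕ) (W : Ω → ℝ), AEStronglyMeasurable[pastSigma a (i + 2)] W P →
    (∀ p : ℕ, MemLp W p P) → ∫ ω, W ω * d i ω ∂P = 0

namespace IsIncrement

variable {P : Measure Ω} [IsProbabilityMeasure P] {a : ℤ → Ω → ℝ} {d e : ℕ → Ω → ℝ}

omit [IsProbabilityMeasure P] in
theorem past_sum (hd : IsIncrement P a d) (i : ℕ) :
    AEStronglyMeasurable[pastSigma a (i + 2)] (fun ω => ∑ j ∈ Finset.range i, d j ω) P := by
  have h : ∀ k ≤ i, AEStronglyMeasurable[pastSigma a (i + 2)]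
      (fun ω => ∑ j ∈ Finset.range k, d j ω) P := by
    intro k
    induction k with
    | zero => exact fun _ => by simpa using! aestronglyMeasurable_const
    | succ k ih =>
      intro hk
      simp_rw [Finset.sum_range_succ]
      exact (ih (by omega)).add (AEStronglyMeasurable.pastSigma_mono (by omega) (hd.past k))
  exact h i le_rfl

omit [IsProbabilityMeasure P] in
theorem memLp_sum (hd : IsIncrement P a d) (i p : ℕ) :
    MemLp (fun ω => ∑ j ∈ Finset.range i, d j ω) p P :=
  memLp_finsetSum _ fun j _ => hd.moments.memLp j p

theorem exists_eLpNorm_le (hd : IsIncrement P a d) (p : ℕ) : ∃ C : ℝ, 0 ≤ C ∧ ∀ n : ℕ,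
    eLpNorm (fun ω => ∑ j ∈ Finset.range n, d j ω) p P ≤
      ENNReal.ofReal (C * (n : ℝ) ^ (1 / 2 : ℝ)) := by
  refine exists_eLpNorm_sum_le (fun i => hd.moments.memLp i)
    (fun p => (hd.moments.bdd p).imp fun _ h => h.2) (fun i k => ?_) p
  exact hd.orth i _ ((hd.past_sum i).pow k) fun p => memLp_nat_pow (hd.memLp_sum i) k p

omit [IsProbabilityMeasure P] in
-- Each new increment is orthogonal to both earlier sums, so in the induction only the diagonal term
-- survives.
theorem integral_sum_mul_sum (hd : IsIncrement P a d) (he : IsIncrement P a e) (n : ℕ) :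
    ∫ ω, (∑ i ∈ Finset.range n, d i ω) * (∑ i ∈ Finset.range n, e i ω) ∂P =
      ∑ i ∈ Finset.range n, ∫ ω, d i ω * e i ω ∂P := by
  induction n with
  | zero => simp
  | succ n ih =>
    simp_rw [Finset.sum_range_succ]
    rw [← ih]
    have h1 := he.orth n _ (hd.past_sum n) (hd.memLp_sum n)
    have h2 := hd.orth n _ (he.past_sum n) (he.memLp_sum n)
    have I0 := integrable_of_memLp_nat (memLp_nat_mul (hd.memLp_sum n) (he.memLp_sum n))
    have I1 := integrable_of_memLp_nat (memLp_nat_mul (hd.memLp_sum n) (he.moments.memLp n))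
    have I2 := integrable_of_memLp_nat (memLp_nat_mul (he.memLp_sum n) (hd.moments.memLp n))
    have I3 := integrable_of_memLp_nat (memLp_nat_mul (hd.moments.memLp n) (he.moments.memLp n))
    have hexp : ∀ ω, (∑ i ∈ Finset.range n, d i ω + d n ω) * (∑ i ∈ Finset.range n, e i ω + e n ω) =
      (∑ i ∈ Finset.range n, d i ω) * (∑ i ∈ Finset.range n, e i ω) +
      (((∑ i ∈ Finset.range n, d i ω) * e n ω + (∑ i ∈ Finset.range n, e i ω) * d n ω) +
      d n ω * e n ω) := fun ω => by ring
    simp_rw [hexp]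
    have I12 : Integrable (fun ω => (∑ i ∈ Finset.range n, d i ω) * e n ω +
      (∑ i ∈ Finset.range n, e i ω) * d n ω) P := I1.add I2
    have I123 : Integrable (fun ω => ((∑ i ∈ Finset.range n, d i ω) * e n ω +
      (∑ i ∈ Finset.range n, e i ω) * d n ω) + d n ω * e n ω) P := I12.add I3
    rw [integral_add I0 I123, integral_add I12 I3, integral_add I1 I2, h1, h2]
    simp

end IsIncrement

/-- The innovation at time i + 3 is independent of everything up to time i + 2, and g of it is
centred; hence orthogonality to any W from that past. -/
theorem isIncrement_mul {P : Measure Ω} [IsProbabilityMeasure P] {a : ℤ → Ω → ℝ}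
    (ha : ∀ t, Measurable (a t)) (hind : iIndepFun a P) {Y : ℕ → Ω → ℝ} {g : ℝ → ℝ}
    (hg : Continuous g) (hY : ∀ i : ℕ, AEStronglyMeasurable[pastSigma a (i + 2)] (Y i) P)
    (hYm : UnifMoments P Y) (hgm : UnifMoments P fun (t : ℤ) ω => g (a t ω))
    (hg0 : ∀ t, ∫ ω, g (a t ω) ∂P = 0) :
    IsIncrement P a fun i ω => Y i ω * g (a (i + 3) ω) := by
  refine ⟨fun i => ?_, hYm.mul (hgm.comp fun i : ℕ => (i : ℤ) + 3), fun i W hW hWm => ?_⟩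
  · refine (AEStronglyMeasurable.pastSigma_mono (by omega) (hY i)).mul ?_
    exact hg.comp_aestronglyMeasurable (aestronglyMeasurable_pastSigma P a _)
  · have h := indepFun_of_pastSigma ha hind (t := (i : ℤ) + 3) (by omega) (hW.mul (hY i))
    have h' := h.comp measurable_id hg.measurable
    have := h'.integral_mul_eq_mul_integral ((hW.mul (hY i)).mono (pastSigma_le ha _))
      (hgm.aesm (i + 3))
    have e : (fun ω => W ω * (Y i ω * g (a (i + 3) ω))) =
        (id ∘ (W * Y i)) * (g ∘ a ((i : ℤ) + 3)) := by
      ext ω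
      simp [mul_assoc]
    rw [e, this]
    have h0 : ∫ ω, (g ∘ a ((i : ℤ) + 3)) ω ∂P = 0 := hg0 _
    rw [h0, mul_zero]

/-! ### Adaptedness and moments of the stationary solution. -/

theorem exists_roots_of_ar2 {φ₁ φ₂ : ℝ} (h1 : |φ₂| < 1) (h2 : φ₁ + φ₂ < 1) (h3 : φ₂ - φ₁ < 1) :
    ∃ r s : ℂ, r + s = φ₁ ∧ r * s = -φ₂ ∧ ‖r‖ < 1 ∧ ‖s‖ < 1 := by
  rw [abs_lt] at h1
  rcases le_total 0 (φ₁ ^ 2 + 4 * φ₂) with h | h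
  · set w := √(φ₁ ^ 2 + 4 * φ₂) with hw
    have hw2 : w ^ 2 = φ₁ ^ 2 + 4 * φ₂ := Real.sq_sqrt h
    have hw0 : 0 ≤ w := Real.sqrt_nonneg _
    -- After squaring this is φ₁ + φ₂ < 1, since (2 − φ₁)² − w² = 4(1 − φ₁ − φ₂); the next bound is
    -- the other side of the triangle.
    have hp : w < 2 - φ₁ := by
      refine lt_of_pow_lt_pow_left₀ 2 (by nlinarith) ?_
      nlinarith
    have hn : w < 2 + φ₁ := by
      refine lt_of_pow_lt_pow_left₀ 2 (by nlinarith) ?_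
      nlinarith
    refine ⟨(((φ₁ + w) / 2 : ℝ) : ℂ), (((φ₁ - w) / 2 : ℝ) : ℂ), ?_, ?_, ?_, ?_⟩
    · rw [← Complex.ofReal_add]; congr 1; ring
    · rw [← Complex.ofReal_mul, ← Complex.ofReal_neg]; congr 1; linear_combination (-1 / 4) * hw2
    · rw [Complex.norm_real, Real.norm_eq_abs, abs_lt]
      constructor <;> linarith
    · rw [Complex.norm_real, Real.norm_eq_abs, abs_lt]
      constructor <;> linarith
  · set w := √(-(φ₁ ^ 2 + 4 * φ₂)) with hw
    have hw2 : w ^ 2 = -(φ₁ ^ 2 + 4 * φ₂) := Real.sq_sqrt (by linarith)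
    -- For conjugate roots the squared modulus is their product −φ₂.
    have hnorm : ∀ x : ℝ, x ^ 2 = w ^ 2 → ‖(⟨φ₁ / 2, x / 2⟩ : ℂ)‖ < 1 := by
      intro x hx
      refine lt_of_pow_lt_pow_left₀ 2 zero_le_one ?_
      rw [← Complex.normSq_eq_norm_sq, Complex.normSq_mk]
      nlinarith
    refine ⟨⟨φ₁ / 2, w / 2⟩, ⟨φ₁ / 2, -w / 2⟩, ?_, ?_, hnorm w rfl, hnorm (-w) (by ring)⟩
    · apply Complex.ext
      · simp
      · simp; ring
    · apply Complex.ext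
      · simp; linear_combination (1 / 4) * hw2
      · simp; ring

/-- An `L²`-bounded solution of a stable first-order recursion is adapted, and inherits
`L^p` bounds from its input. -/
theorem stable_first_order {P : Measure Ω} [IsProbabilityMeasure P] {a : ℤ → Ω → ℝ}
    (ha : ∀ t, Measurable (a t)) {y x : ℤ → Ω → ℂ} {r : ℂ} (hr : ‖r‖ < 1)
    (hy : ∀ t, AEStronglyMeasurable (y t) P) {B : ℝ}
    (hyB : ∀ t, eLpNorm (y t) 2 P ≤ ENNReal.ofReal B)
    (hx : ∀ t, AEStronglyMeasurable[pastSigma a t] (x t) P)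
    (hrec : ∀ t, ∀ᵐ ω ∂P, y t ω = r * y (t - 1) ω + x t ω) :
    (∀ t, AEStronglyMeasurable[pastSigma a t] (y t) P) ∧
    ∀ p : ℕ, 1 ≤ p → ∀ C : ℝ, 0 ≤ C → (∀ t, eLpNorm (x t) p P ≤ ENNReal.ofReal C) →
      ∀ t, eLpNorm (y t) p P ≤ ENNReal.ofReal ((1 - ‖r‖)⁻¹ * C) := by
  have hiter : ∀ (k : ℕ) (t : ℤ), ∀ᵐ ω ∂P,
      y t ω = r ^ k * y (t - k) ω + ∑ j ∈ Finset.range k, r ^ j * x (t - j) ω := by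
    intro k t
    induction k with
    | zero => simp
    | succ k ih =>
      filter_upwards [ih, hrec (t - k)] with ω h1 h2
      rw [h1, h2, Finset.sum_range_succ]
      rw [show t - ((k + 1 : ℕ) : ℤ) = t - k - 1 by push_cast; ring]
      ring
  set S : ℤ → ℕ → Ω → ℂ := fun t k ω => ∑ j ∈ Finset.range k, r ^ j * x (t - j) ω with hS
  have hSpast : ∀ t k, AEStronglyMeasurable[pastSigma a t] (S t k) P := by
    intro t k
    induction k with
    | zero => simpa [hS] using! aestronglyMeasurable_const
    | succ k ih =>
      simp_rw [hS, Finset.sum_range_succ]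
      refine ih.add (AEStronglyMeasurable.const_mul ?_ _)
      exact AEStronglyMeasurable.pastSigma_mono (by omega) (hx _)
  have hSm : ∀ t k, AEStronglyMeasurable (S t k) P := fun t k =>
    (hSpast t k).mono (pastSigma_le ha t)
  -- The remainder r^k y_{t-k} of the backward iteration tends to 0 in L² because y is L²-bounded,
  -- so y is the limit of finite sums that are adapted.
  have hlim : ∀ t, Tendsto (fun k => eLpNorm (S t k - y t) 2 P) atTop (nhds 0) := by
    intro t
    have h0 : Tendsto (fun k : ℕ => ENNReal.ofReal (‖r‖ ^ k * B)) atTop (nhds 0) := by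
      have := (tendsto_pow_atTop_nhds_zero_of_lt_one (norm_nonneg r) hr).mul_const B
      rw [zero_mul] at this
      simpa using ENNReal.tendsto_ofReal this
    refine tendsto_of_tendsto_of_tendsto_of_le_of_le tendsto_const_nhds h0 (fun _ => zero_le) ?_
    intro k
    have e : S t k - y t =ᵐ[P] (-(r ^ k)) • y (t - k) := by
      filter_upwards [hiter k t] with ω hω
      simp only [Pi.sub_apply, Pi.smul_apply, smul_eq_mul, hS]
      rw [hω]
      ring
    simp only
    rw [eLpNorm_congr_ae e, eLpNorm_const_smul, enorm_neg, ENNReal.ofReal_mul (by positivity),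
      ← norm_pow, ofReal_norm]
    gcongr
    exact hyB _
  have hae : ∀ t, ∃ ns : ℕ → ℕ, StrictMono ns ∧
      ∀ᵐ ω ∂P, Tendsto (fun i => S t (ns i) ω) atTop (nhds (y t ω)) := fun t =>
    (tendstoInMeasure_of_tendsto_eLpNorm two_ne_zero (hSm t) (hy t) (hlim t)).exists_seq_tendsto_ae
  constructor
  · intro t
    obtain ⟨ns, -, h⟩ := hae t
    refine ⟨fun ω => limUnder atTop fun i => (hSpast t (ns i)).mk _ ω,
      @StronglyMeasurable.limUnder _ _ _ (pastSigma a t) _ _ _ _ _ _ _ fun i => (hSpast t (ns i)).stronglyMeasurable_mk, ?_⟩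
    filter_upwards [h, ae_all_iff.2 fun i => (hSpast t (ns i)).ae_eq_mk] with ω h1 h2
    exact ((h1.congr h2).limUnder_eq).symm
  · intro p hp C hC hxC t
    obtain ⟨ns, -, h⟩ := hae t
    -- Convergence is known only in L²; the L^p bound passes to the limit by Fatou along an almost
    -- surely convergent subsequence.
    refine Lp.eLpNorm_le_of_ae_tendsto (.of_forall fun i => ?_) (fun i => hSm t (ns i)) h
    have hbound : ∀ k, eLpNorm (S t k) p P ≤
        ENNReal.ofReal ((∑ j ∈ Finset.range k, ‖r‖ ^ j) * C) := by
      intro k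
      induction k with
      | zero => simp [hS]
      | succ k ih =>
        have hm : AEStronglyMeasurable (fun ω => r ^ k * x (t - k) ω) P :=
          ((hx _).mono (pastSigma_le ha _)).const_mul _
        have e : S t (k + 1) = S t k + fun ω => r ^ k * x (t - k) ω := by
          ext ω; exact Finset.sum_range_succ _ _
        rw [e, Finset.sum_range_succ, add_mul, ENNReal.ofReal_add (by positivity) (by positivity)]
        refine (eLpNorm_add_le (hSm t k) hm (by exact_mod_cast hp)).trans (add_le_add ih ?_)
        have := eLpNorm_const_smul (r ^ k) (x (t - k)) (p : ENNReal) P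
        have e : ((r ^ k) • x (t - k)) = fun ω => r ^ k * x (t - k) ω := rfl
        rw [e] at this
        rw [this, ENNReal.ofReal_mul (by positivity), ← norm_pow, ofReal_norm]
        gcongr
        exact hxC _
    refine (hbound _).trans (ENNReal.ofReal_le_ofReal ?_)
    gcongr
    rw [← tsum_geometric_of_lt_one (norm_nonneg r) hr]
    exact (summable_geometric_of_lt_one (norm_nonneg r) hr).sum_le_tsum _ fun _ _ => by positivity

namespace IsStationaryGaussianAR2

variable {P : Measure Ω} [IsProbabilityMeasure P] {φ₁ φ₂ : ℝ} {v : ℝ≥0} {z a : ℤ → Ω → ℝ}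

omit [IsProbabilityMeasure P] in
theorem congr_innovation (hz : IsStationaryGaussianAR2 P φ₁ φ₂ v z a) {b : ℤ → Ω → ℝ}
    (h : ∀ t, a t =ᵐ[P] b t) : IsStationaryGaussianAR2 P φ₁ φ₂ v z b where
  variance_pos := hz.variance_pos
  innovation_law t := (hz.innovation_law t).congr (h t).symm
  innovation_indep := hz.innovation_indep.congr h
  recursion t := by
    filter_upwards [hz.recursion t, h t] with ω h1 h2
    rw [h1, h2]
  memLp := hz.memLp
  mean_zero := hz.mean_zero
  cov_shift := hz.cov_shift

omit [IsProbabilityMeasure P] in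
theorem exists_measurable_innovation (hz : IsStationaryGaussianAR2 P φ₁ φ₂ v z a) :
    ∃ b : ℤ → Ω → ℝ, (∀ t, Measurable (b t)) ∧ IsStationaryGaussianAR2 P φ₁ φ₂ v z b :=
  ⟨fun t => (hz.innovation_law t).aemeasurable.mk, fun _ => AEMeasurable.measurable_mk _,
    hz.congr_innovation fun t => (hz.innovation_law t).aemeasurable.ae_eq_mk⟩

omit [IsProbabilityMeasure P] in
theorem unifMoments_innovation (hz : IsStationaryGaussianAR2 P φ₁ φ₂ v z a) :
    UnifMoments P a := by
  refine ⟨fun t => (hz.innovation_law t).aemeasurable.aestronglyMeasurable, fun p => ?_⟩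
  have hfin : eLpNorm id p (gaussianReal 0 v) ≠ ⊤ :=
    (memLp_id_gaussianReal' (p : ENNReal) (by simp)).eLpNorm_ne_top
  refine ⟨(eLpNorm id p (gaussianReal 0 v)).toReal, ENNReal.toReal_nonneg, fun t => ?_⟩
  rw [ENNReal.ofReal_toReal hfin, ← (hz.innovation_law t).map_eq,
    eLpNorm_map_measure aestronglyMeasurable_id (hz.innovation_law t).aemeasurable]
  rfl

theorem integral_mul_shift (hz : IsStationaryGaussianAR2 P φ₁ φ₂ v z a) (t k : ℤ) :
    ∫ ω, z (t + k) ω * z t ω ∂P = ∫ ω, z k ω * z 0 ω ∂P := by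
  have h := hz.cov_shift t k
  rw [covariance_eq_sub (hz.memLp _) (hz.memLp _), covariance_eq_sub (hz.memLp _) (hz.memLp _)] at h
  simpa [hz.mean_zero] using h

theorem eLpNorm_two_le (hz : IsStationaryGaussianAR2 P φ₁ φ₂ v z a) :
    ∃ B : ℝ, 0 ≤ B ∧ ∀ t, eLpNorm (z t) 2 P ≤ ENNReal.ofReal B := by
  refine ⟨1 + ∫ ω, z 0 ω * z 0 ω ∂P, ?_, fun t => ?_⟩
  · have : 0 ≤ ∫ ω, z 0 ω * z 0 ω ∂P := integral_nonneg fun ω => mul_self_nonneg _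
    linarith
  have h0 : 0 ≤ ∫ ω, z 0 ω * z 0 ω ∂P := integral_nonneg fun ω => mul_self_nonneg _
  have := eLpNorm_le_ofReal_of_integral_pow_le (p := 1) le_rfl (by simpa using hz.memLp t)
    (K := 1 + ∫ ω, z 0 ω * z 0 ω ∂P) (by linarith) (by
      have h1 := hz.integral_mul_shift t 0
      simp only [add_zero] at h1
      simp only [mul_one, sq]
      rw [h1]
      nlinarith)
  simpa using this

/-- The operator factors as (1 − sB)(1 − rB), B being the backward shift. The first-order result is
applied to y_t = z_t − r z_{t-1} with input a and root s, then to z with input y and root r. No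
partial fractions occur, so equal roots need no separate treatment. -/
theorem past_and_moments (h1 : |φ₂| < 1) (h2 : φ₁ + φ₂ < 1) (h3 : φ₂ - φ₁ < 1)
    (ha : ∀ t, Measurable (a t)) (hz : IsStationaryGaussianAR2 P φ₁ φ₂ v z a) :
    (∀ t, AEStronglyMeasurable[pastSigma a t] (z t) P) ∧ UnifMoments P z := by
  obtain ⟨r, s, hrs, hrs', hr, hs⟩ := exists_roots_of_ar2 h1 h2 h3
  obtain ⟨B, hB, hzB⟩ := hz.eLpNorm_two_le
  set zc : ℤ → Ω → ℂ := fun t ω => (z t ω : ℂ) with hzc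
  have hnorm : ∀ (f : Ω → ℝ) (p : ENNReal), eLpNorm (fun ω => (f ω : ℂ)) p P = eLpNorm f p P :=
    fun f p => eLpNorm_congr_norm_ae (.of_forall fun ω => by simp)
  have hzcm : ∀ t, AEStronglyMeasurable (zc t) P := fun t =>
    Complex.continuous_ofReal.comp_aestronglyMeasurable (hz.memLp t).1
  have hym : ∀ t, AEStronglyMeasurable (fun ω => zc t ω - r * zc (t - 1) ω) P := fun t =>
    (hzcm t).sub ((hzcm _).const_mul r)
  have hyB : ∀ t, eLpNorm (fun ω => zc t ω - r * zc (t - 1) ω) 2 P ≤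
      ENNReal.ofReal (B + ‖r‖ * B) := by
    intro t
    refine (eLpNorm_sub_le (hzcm t) ((hzcm _).const_mul r) (by norm_num)).trans ?_
    rw [ENNReal.ofReal_add hB (by positivity)]
    refine add_le_add ((hnorm _ _).trans_le (hzB t)) ?_
    have := eLpNorm_const_smul r (zc (t - 1)) 2 P
    have e : (r • zc (t - 1)) = fun ω => r * zc (t - 1) ω := rfl
    rw [e] at this
    rw [this, ENNReal.ofReal_mul (by positivity), ofReal_norm]
    gcongr
    exact (hnorm _ _).trans_le (hzB _)
  have hax : ∀ t, AEStronglyMeasurable[pastSigma a t] (fun ω => (a t ω : ℂ)) P := fun t =>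
    Complex.continuous_ofReal.comp_aestronglyMeasurable (aestronglyMeasurable_pastSigma P a t)
  have hyrec : ∀ t, ∀ᵐ ω ∂P, zc t ω - r * zc (t - 1) ω =
      s * (zc (t - 1) ω - r * zc (t - 1 - 1) ω) + (a t ω : ℂ) := by
    intro t
    filter_upwards [hz.recursion t] with ω hω
    simp only [hzc]
    rw [hω, show t - 1 - 1 = t - 2 by ring]
    push_cast
    linear_combination (-(z (t - 1) ω : ℂ)) * hrs + (z (t - 2) ω : ℂ) * hrs'
  obtain ⟨hypast, hybd⟩ := stable_first_order ha hs hym hyB hax hyrec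
  obtain ⟨hzpast, hzbd⟩ := stable_first_order ha hr hzcm
    (fun t => (hnorm _ _).trans_le (hzB t)) hypast (fun t => .of_forall fun ω => by simp)
  refine ⟨fun t => Complex.continuous_re.comp_aestronglyMeasurable (hzpast t), fun t =>
    (hz.memLp t).1, fun p => ?_⟩
  rcases Nat.eq_zero_or_pos p with rfl | hp
  · exact ⟨0, le_rfl, by simp⟩
  obtain ⟨C, hC, haC⟩ := hz.unifMoments_innovation.bdd p
  have hr' : 0 < 1 - ‖r‖ := by linarith
  have hs' : 0 < 1 - ‖s‖ := by linarith
  refine ⟨(1 - ‖r‖)⁻¹ * ((1 - ‖s‖)⁻¹ * C), by positivity, fun t => ?_⟩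
  rw [← hnorm]
  exact hzbd p hp _ (by positivity) (hybd p hp C hC fun t => (hnorm _ _).trans_le (haC t)) t

end IsStationaryGaussianAR2

/-! ### Negative moments of products of minors. -/

theorem lintegral_Ioc_enorm_rpow_lt_top :
    ∫⁻ y, (Set.Ioc (0 : ℝ) 1).indicator (fun y => ‖y‖ₑ ^ (-1 / 2 : ℝ)) y < ⊤ := by
  rw [lintegral_indicator measurableSet_Ioc]
  have h := (intervalIntegral.intervalIntegrable_rpow' (a := 0) (b := 1)
    (by norm_num : (-1 : ℝ) < -1 / 2)).1.hasFiniteIntegral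
  refine lt_of_le_of_lt (le_of_eq ?_) h
  refine setLIntegral_congr_fun measurableSet_Ioc fun y hy => ?_
  simp only
  rw [Real.enorm_of_nonneg hy.1.le, Real.enorm_of_nonneg (Real.rpow_nonneg hy.1.le _),
    ENNReal.ofReal_rpow_of_pos hy.1]

/-- The Gaussian density is bounded and |y|^{-1/2} is integrable near 0 and at most 1 away from it,
which gives a bound independent of the shift b; the factor A is scaled out. -/
theorem exists_lintegral_gaussianReal_rpow_le {v : ℝ≥0} (hv : v ≠ 0) :
    ∃ K : ENNReal, K ≠ ⊤ ∧ ∀ A b : ℝ,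
      ∫⁻ x, ‖b + A * x‖ₑ ^ (-1 / 2 : ℝ) ∂gaussianReal 0 v ≤ K * ‖A‖ₑ ^ (-1 / 2 : ℝ) := by
  set f : ℝ → ENNReal := (Set.Ioc (0 : ℝ) 1).indicator (fun y => ‖y‖ₑ ^ (-1 / 2 : ℝ)) with hf
  have hfm : Measurable f := (measurable_enorm.pow_const _).indicator measurableSet_Ioc
  set M : ENNReal := ENNReal.ofReal (√(2 * Real.pi * v))⁻¹ with hM
  have hpdf : ∀ x, gaussianPDF 0 v x ≤ M := by
    intro x
    refine ENNReal.ofReal_le_ofReal ?_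
    rw [gaussianPDFReal_def]
    refine mul_le_of_le_one_right (by positivity) (Real.exp_le_one_iff.2 ?_)
    rw [neg_div, neg_nonpos]
    positivity
  have hbd : ∀ g : ℝ → ENNReal, Measurable g →
      ∫⁻ x, g x ∂gaussianReal 0 v ≤ M * ∫⁻ x, g x := by
    intro g hg
    rw [gaussianReal_of_var_ne_zero _ hv,
      lintegral_withDensity_eq_lintegral_mul _ (measurable_gaussianPDF 0 v) hg,
      ← lintegral_const_mul _ hg]
    exact lintegral_mono fun x => mul_le_mul' (hpdf x) le_rfl
  have hone : ∀ c : ℝ, ∫⁻ x, ‖c + x‖ₑ ^ (-1 / 2 : ℝ) ∂gaussianReal 0 v ≤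
      1 + M * (∫⁻ y, f y) + M * ∫⁻ y, f y := by
    intro c
    have hpt : ∀ᵐ x ∂gaussianReal 0 v,
        ‖c + x‖ₑ ^ (-1 / 2 : ℝ) ≤ 1 + f (c + x) + f (-(c + x)) := by
      have h0 : ∀ᵐ x ∂(volume : Measure ℝ), x ≠ -c := by
        simp [ae_iff]
      filter_upwards [gaussianReal_absolutelyContinuous 0 hv h0] with x hx
      have hx' : c + x ≠ 0 := fun h => hx (by linarith)
      generalize c + x = y at hx'
      rcases le_total 1 |y| with h1 | h1
      · refine le_trans ?_ (le_trans le_self_add le_self_add)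
        refine ENNReal.rpow_le_one_of_one_le_of_neg ?_ (by norm_num)
        rw [← ofReal_norm, Real.norm_eq_abs]
        simpa using h1
      · rw [abs_le] at h1
        rcases lt_or_gt_of_ne hx' with h2 | h2
        · refine le_trans (le_of_eq ?_) le_add_self
          rw [hf, Set.indicator_of_mem (by constructor <;> linarith), enorm_neg]
        · refine le_trans (le_trans (le_of_eq ?_) le_add_self) le_self_add
          rw [hf, Set.indicator_of_mem (by constructor <;> linarith)]
    refine (lintegral_mono_ae hpt).trans ?_
    have m1 : Measurable fun x => f (c + x) := hfm.comp (measurable_const_add c)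
    have m2 : Measurable fun x => f (-(c + x)) := hfm.comp (measurable_const_add c).neg
    rw [lintegral_add_right _ m2, lintegral_add_right _ m1]
    refine add_le_add (add_le_add (by simp) ?_) ?_
    · refine (hbd _ m1).trans_eq ?_
      rw [lintegral_add_left_eq_self f c]
    · refine (hbd _ m2).trans_eq ?_
      rw [lintegral_add_left_eq_self (fun y => f (-y)) c, lintegral_neg_eq_self]
  have hfin : ∫⁻ y, f y ≠ ⊤ := lintegral_Ioc_enorm_rpow_lt_top.ne
  have hMtop : M ≠ ⊤ := ENNReal.ofReal_ne_top
  refine ⟨1 + M * (∫⁻ y, f y) + M * ∫⁻ y, f y, by finiteness, fun A b => ?_⟩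
  -- For A = 0 the right side is infinite, since 0^{-1/2} = ⊤ and the constant is at least 1.
  rcases eq_or_ne A 0 with rfl | hA
  · have : (‖(0 : ℝ)‖ₑ) ^ (-1 / 2 : ℝ) = ⊤ := by
      rw [enorm_zero, ENNReal.zero_rpow_of_neg (by norm_num)]
    rw [this, ENNReal.mul_top (by simp [add_assoc])]
    exact le_top
  · have e : ∀ x, ‖b + A * x‖ₑ ^ (-1 / 2 : ℝ) =
        ‖b / A + x‖ₑ ^ (-1 / 2 : ℝ) * ‖A‖ₑ ^ (-1 / 2 : ℝ) := by
      intro x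
      rw [← ENNReal.mul_rpow_of_ne_top (by simp) (by simp), ← enorm_mul]
      congr 2
      field_simp
    simp_rw [e]
    have hm : Measurable fun x => ‖b / A + x‖ₑ ^ (-1 / 2 : ℝ) :=
      (measurable_enorm.comp (measurable_const_add _)).pow_const _
    rw [lintegral_mul_const _ hm]
    gcongr
    exact hone _

namespace IsStationaryGaussianAR2

variable {P : Measure Ω} [IsProbabilityMeasure P] {φ₁ φ₂ : ℝ} {v : ℝ≥0} {z a : ℤ → Ω → ℝ}

/-- Integrating out one innovation from an inverse square root of an affine function of it. -/
theorem exists_lintegral_affine_rpow_le (ha : ∀ t, Measurable (a t))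
    (hz : IsStationaryGaussianAR2 P φ₁ φ₂ v z a) :
    ∃ K : ENNReal, K ≠ ⊤ ∧ ∀ (s t : ℤ), s < t → ∀ A B : Ω → ℝ,
      AEStronglyMeasurable[pastSigma a s] A P → AEStronglyMeasurable[pastSigma a s] B P →
      ∫⁻ ω, ‖B ω + A ω * a t ω‖ₑ ^ (-1 / 2 : ℝ) ∂P ≤ K * ∫⁻ ω, ‖A ω‖ₑ ^ (-1 / 2 : ℝ) ∂P := by
  obtain ⟨K, hK, h⟩ := exists_lintegral_gaussianReal_rpow_le hz.variance_pos.ne'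
  refine ⟨K, hK, fun s t hst A B hA hB => ?_⟩
  have hAm : AEMeasurable A P := (hA.mono (pastSigma_le ha s)).aemeasurable
  have hBm : AEMeasurable B P := (hB.mono (pastSigma_le ha s)).aemeasurable
  have hind := indepFun_of_pastSigma ha hz.innovation_indep hst (hB.prodMk hA)
  have hBA : AEMeasurable (fun ω => (B ω, A ω)) P := hBm.prodMk hAm
  have hmap := (indepFun_iff_map_prod_eq_prod_map_map hBA (ha t).aemeasurable).1 hind
  have hg : Measurable fun q : (ℝ × ℝ) × ℝ => ‖q.1.1 + q.1.2 * q.2‖ₑ ^ (-1 / 2 : ℝ) := by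
    fun_prop
  have hg2 : Measurable fun q : ℝ × ℝ => ‖q.2‖ₑ ^ (-1 / 2 : ℝ) := by fun_prop
  calc ∫⁻ ω, ‖B ω + A ω * a t ω‖ₑ ^ (-1 / 2 : ℝ) ∂P
      = ∫⁻ q, ‖q.1.1 + q.1.2 * q.2‖ₑ ^ (-1 / 2 : ℝ) ∂(P.map fun ω => ((B ω, A ω), a t ω)) := by
        rw [lintegral_map' hg.aemeasurable (hBA.prodMk (ha t).aemeasurable)]
    _ = ∫⁻ q, ∫⁻ x, ‖q.1 + q.2 * x‖ₑ ^ (-1 / 2 : ℝ) ∂(gaussianReal 0 v)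
          ∂(P.map fun ω => (B ω, A ω)) := by
        rw [hmap, (hz.innovation_law t).map_eq, lintegral_prod _ hg.aemeasurable]
    _ ≤ ∫⁻ q, K * ‖q.2‖ₑ ^ (-1 / 2 : ℝ) ∂(P.map fun ω => (B ω, A ω)) :=
        lintegral_mono fun q => h q.2 q.1
    _ = K * ∫⁻ ω, ‖A ω‖ₑ ^ (-1 / 2 : ℝ) ∂P := by
        rw [lintegral_const_mul _ hg2, lintegral_map' hg2.aemeasurable hBA]

/-- A `2 × 2` minor of the design matrix with rows `(z (s - 1), z (s - 2))`. -/
abbrev minor (z : ℤ → Ω → ℝ) (t : ℤ) (ω : Ω) : ℝ := z (t + 2) ω ^ 2 - z (t + 3) ω * z (t + 1) ω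

/-- The last minor, with t = 3m, is affine in a_{t+3} with slope −z_{t+1}, and z_{t+1} is affine in
a_{t+1} with slope 1. Integrating out a_{t+3} and then a_{t+1} removes that minor at the price of
K². The step 3 makes the earlier minors measurable with respect to the past at time t. -/
theorem lintegral_prod_minor_lt_top (ha : ∀ t, Measurable (a t))
    (hz : IsStationaryGaussianAR2 P φ₁ φ₂ v z a)
    (hp : ∀ t, AEStronglyMeasurable[pastSigma a t] (z t) P) (m : ℕ) :
    ∫⁻ ω, ‖∏ k ∈ Finset.range m, minor z (3 * k) ω‖ₑ ^ (-1 / 2 : ℝ) ∂P < ⊤ := by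
  obtain ⟨K, hK, h⟩ := hz.exists_lintegral_affine_rpow_le ha
  have hDp : ∀ m : ℕ, AEStronglyMeasurable[pastSigma a (3 * m)]
      (fun ω => ∏ k ∈ Finset.range m, minor z (3 * k) ω) P := by
    intro m
    induction m with
    | zero => simpa using! aestronglyMeasurable_const
    | succ m ih =>
      simp_rw [Finset.prod_range_succ]
      have q : ∀ t : ℤ, t ≤ 3 * ((m + 1 : ℕ) : ℤ) →
          AEStronglyMeasurable[pastSigma a (3 * ((m + 1 : ℕ) : ℤ))] (z t) P :=
        fun t ht => AEStronglyMeasurable.pastSigma_mono ht (hp t)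
      refine (AEStronglyMeasurable.pastSigma_mono (by push_cast; omega) ih).mul
        (((q (3 * m + 2) ?_).pow 2).sub ((q (3 * m + 3) ?_).mul (q (3 * m + 1) ?_))) <;>
      · push_cast; omega
  induction m with
  | zero => simp
  | succ m ih =>
    set D : Ω → ℝ := fun ω => ∏ k ∈ Finset.range m, minor z (3 * k) ω with hD
    set t : ℤ := 3 * m with ht
    have hDm := hDp m
    have pz : ∀ s r : ℤ, s ≤ r → AEStronglyMeasurable[pastSigma a r] (z s) P :=
      fun s r hs => AEStronglyMeasurable.pastSigma_mono hs (hp s)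
    have pD : ∀ r : ℤ, t ≤ r → AEStronglyMeasurable[pastSigma a r] D P :=
      fun r hs => AEStronglyMeasurable.pastSigma_mono hs hDm
    have h1 := h (t + 2) (t + 3) (by omega) (fun ω => -(D ω * z (t + 1) ω))
      (fun ω => D ω * (z (t + 2) ω ^ 2 - (φ₁ * z (t + 2) ω + φ₂ * z (t + 1) ω) * z (t + 1) ω))
      (((pD _ (by omega)).mul (pz (t + 1) _ (by omega))).neg)
      ((pD _ (by omega)).mul (((pz (t + 2) _ (by omega)).pow 2).sub
        ((((pz (t + 2) _ (by omega)).const_mul φ₁).add ((pz (t + 1) _ (by omega)).const_mul φ₂)).mul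
          (pz (t + 1) _ (by omega)))))
    have h2 := h t (t + 1) (by omega) D (fun ω => D ω * (φ₁ * z t ω + φ₂ * z (t - 1) ω))
      (pD _ le_rfl)
      ((pD _ le_rfl).mul (((pz t _ (by omega)).const_mul φ₁).add
        ((pz (t - 1) _ (by omega)).const_mul φ₂)))
    have e1 : ∫⁻ ω, ‖∏ k ∈ Finset.range (m + 1), minor z (3 * k) ω‖ₑ ^ (-1 / 2 : ℝ) ∂P =
        ∫⁻ ω, ‖D ω * (z (t + 2) ω ^ 2 - (φ₁ * z (t + 2) ω + φ₂ * z (t + 1) ω) * z (t + 1) ω) +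
          -(D ω * z (t + 1) ω) * a (t + 3) ω‖ₑ ^ (-1 / 2 : ℝ) ∂P := by
      refine lintegral_congr_ae ?_
      filter_upwards [hz.recursion (t + 3)] with ω hω
      rw [show t + 3 - 1 = t + 2 by ring, show t + 3 - 2 = t + 1 by ring] at hω
      congr 2
      rw [Finset.prod_range_succ, ← ht]
      simp only [minor]
      rw [hω]
      ring
    have e2 : ∫⁻ ω, ‖-(D ω * z (t + 1) ω)‖ₑ ^ (-1 / 2 : ℝ) ∂P =
        ∫⁻ ω, ‖D ω * (φ₁ * z t ω + φ₂ * z (t - 1) ω) + D ω * a (t + 1) ω‖ₑ ^ (-1 / 2 : ℝ) ∂P := by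
      refine lintegral_congr_ae ?_
      filter_upwards [hz.recursion (t + 1)] with ω hω
      rw [show t + 1 - 1 = t by ring, show t + 1 - 2 = t - 1 by ring] at hω
      simp only [enorm_neg]
      congr 2
      rw [hω]
      ring
    rw [e1]
    refine h1.trans_lt ?_
    rw [e2]
    refine ENNReal.mul_lt_top hK.lt_top (h2.trans_lt ?_)
    exact ENNReal.mul_lt_top hK.lt_top ih

end IsStationaryGaussianAR2

/-- By the Cauchy–Binet (Lagrange) identity the Gram determinant is the sum of the squares of all
minors. The proof keeps one minor: it splits off the two indices, applies Cauchy–Schwarz to the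
rest, and bounds the mixed terms by 2pqc ≤ p²y + q²x when c² ≤ xy. -/
theorem sq_minor_le_gram {ι : Type*} [DecidableEq ι] (s : Finset ι) (u w : ι → ℝ) {i j : ι}
    (hi : i ∈ s) (hj : j ∈ s) (hij : i ≠ j) :
    (u i * w j - u j * w i) ^ 2 ≤
      (∑ k ∈ s, u k ^ 2) * (∑ k ∈ s, w k ^ 2) - (∑ k ∈ s, u k * w k) ^ 2 := by
  have hsplit : ∀ f : ι → ℝ, ∑ k ∈ s, f k = f i + (f j + ∑ k ∈ (s.erase i).erase j, f k) := by
    intro f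
    rw [← Finset.add_sum_erase s f hi,
      ← Finset.add_sum_erase (s.erase i) f (Finset.mem_erase.2 ⟨hij.symm, hj⟩)]
  have hcs := Finset.sum_mul_sq_le_sq_mul_sq ((s.erase i).erase j) u w
  have hx : 0 ≤ ∑ k ∈ (s.erase i).erase j, u k ^ 2 := Finset.sum_nonneg fun _ _ => sq_nonneg _
  have hy : 0 ≤ ∑ k ∈ (s.erase i).erase j, w k ^ 2 := Finset.sum_nonneg fun _ _ => sq_nonneg _
  rw [hsplit, hsplit, hsplit]
  generalize ∑ k ∈ (s.erase i).erase j, u k ^ 2 = x at *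
  generalize ∑ k ∈ (s.erase i).erase j, w k ^ 2 = y at *
  generalize ∑ k ∈ (s.erase i).erase j, u k * w k = c at *
  have key : ∀ p q : ℝ, 2 * (p * q) * c ≤ p ^ 2 * y + q ^ 2 * x := by
    intro p q
    have h1 : (2 * (p * q) * c) ^ 2 ≤ (p ^ 2 * y + q ^ 2 * x) ^ 2 := by
      have h2 : (p * q) ^ 2 * c ^ 2 ≤ (p * q) ^ 2 * (x * y) := by gcongr
      nlinarith [sq_nonneg (p ^ 2 * y - q ^ 2 * x)]
    exact abs_le_of_sq_le_sq' h1 (by positivity) |>.2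
  have k1 := key (u i) (w i)
  have k2 := key (u j) (w j)
  nlinarith

/-! ### Autocovariances and the basis of score sums. -/

/-- `acov P z k` is `E (z k * z 0)`. -/
noncomputable def acov (P : Measure Ω) (z : ℤ → Ω → ℝ) (k : ℤ) : ℝ := ∫ ω, z k ω * z 0 ω ∂P

namespace IsStationaryGaussianAR2

variable {P : Measure Ω} [IsProbabilityMeasure P] {φ₁ φ₂ : ℝ} {v : ℝ≥0} {z a : ℤ → Ω → ℝ}

omit [IsProbabilityMeasure P] in
theorem integral_innovation (hz : IsStationaryGaussianAR2 P φ₁ φ₂ v z a) (t : ℤ) :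
    ∫ ω, a t ω ∂P = 0 := by
  rw [(hz.innovation_law t).integral_eq]
  simp

omit [IsProbabilityMeasure P] in
theorem integral_innovation_sq (hz : IsStationaryGaussianAR2 P φ₁ φ₂ v z a) (t : ℤ) :
    ∫ ω, a t ω ^ 2 ∂P = v := by
  have h := (hz.innovation_law t).variance_eq
  rw [variance_id_gaussianReal, variance_of_integral_eq_zero (hz.innovation_law t).aemeasurable
    (hz.integral_innovation t)] at h
  simpa using h

omit [IsProbabilityMeasure P] in
theorem integral_past_mul (ha : ∀ t, Measurable (a t))
    (hz : IsStationaryGaussianAR2 P φ₁ φ₂ v z a) {s t : ℤ} (hst : s < t) {Y : Ω → ℝ} {g : ℝ → ℝ}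
    (hY : AEStronglyMeasurable[pastSigma a s] Y P) (hg : Continuous g) :
    ∫ ω, Y ω * g (a t ω) ∂P = (∫ ω, Y ω ∂P) * ∫ ω, g (a t ω) ∂P := by
  have h := (indepFun_of_pastSigma ha hz.innovation_indep hst hY).comp measurable_id hg.measurable
  exact h.integral_fun_mul_eq_mul_integral (hY.mono (pastSigma_le ha s))
    (hg.measurable.comp (ha t)).aestronglyMeasurable

theorem integral_mul_eq_acov (hz : IsStationaryGaussianAR2 P φ₁ φ₂ v z a) (s t : ℤ) :
    ∫ ω, z s ω * z t ω ∂P = acov P z (s - t) := by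
  have := hz.integral_mul_shift t (s - t)
  rwa [show t + (s - t) = s by ring] at this

omit [IsProbabilityMeasure P] in
theorem integral_mul_innovation (ha : ∀ t, Measurable (a t))
    (hz : IsStationaryGaussianAR2 P φ₁ φ₂ v z a)
    (hp : ∀ t, AEStronglyMeasurable[pastSigma a t] (z t) P) {s t : ℤ} (hst : s < t) :
    ∫ ω, z s ω * a t ω ∂P = 0 := by
  have := hz.integral_past_mul ha hst (hp s) continuous_id
  simpa [hz.mean_zero] using this

/-- The Yule–Walker equations. -/
theorem yule_walker (ha : ∀ t, Measurable (a t))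
    (hz : IsStationaryGaussianAR2 P φ₁ φ₂ v z a)
    (hp : ∀ t, AEStronglyMeasurable[pastSigma a t] (z t) P) (hm : UnifMoments P z) :
    acov P z 1 = φ₁ * acov P z 0 + φ₂ * acov P z 1 ∧
    acov P z 2 = φ₁ * acov P z 1 + φ₂ * acov P z 0 ∧
    acov P z 0 = φ₁ * acov P z 1 + φ₂ * acov P z 2 + v := by
  have ham := hz.unifMoments_innovation
  have I : ∀ s t, Integrable (fun ω => z s ω * z t ω) P := fun s t =>
    ((hm.comp fun _ : Unit => s).mul (hm.comp fun _ : Unit => t)).integrable ()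
  have Ia : ∀ s t, Integrable (fun ω => z s ω * a t ω) P := fun s t =>
    ((hm.comp fun _ : Unit => s).mul (ham.comp fun _ : Unit => t)).integrable ()
  have Iaa : Integrable (fun ω => a 0 ω ^ 2) P := by
    simpa [sq] using! (ham.mul ham).integrable 0
  -- The recursion at time 0 is multiplied by z_s and integrated, for s = 0, −1, −2.
  have hexp : ∀ s : ℤ, ∫ ω, z 0 ω * z s ω ∂P = φ₁ * (∫ ω, z (-1) ω * z s ω ∂P) +
      φ₂ * (∫ ω, z (-2) ω * z s ω ∂P) + ∫ ω, z s ω * a 0 ω ∂P := by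
    intro s
    have J1 : Integrable (fun ω => φ₁ * (z (-1) ω * z s ω) + φ₂ * (z (-2) ω * z s ω)) P :=
      ((I _ _).const_mul _).add ((I _ _).const_mul _)
    rw [← integral_const_mul, ← integral_const_mul,
      ← integral_add ((I _ _).const_mul _) ((I _ _).const_mul _), ← integral_add J1 (Ia _ _)]
    refine integral_congr_ae ?_
    filter_upwards [hz.recursion 0] with ω hω
    rw [hω]
    simp only [zero_sub]
    ring
  have hsymm : ∀ k, acov P z (-k) = acov P z k := fun k => by
    rw [← sub_zero k, ← hz.integral_mul_eq_acov k 0, show -(k - 0) = 0 - k by ring,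
      ← hz.integral_mul_eq_acov 0 k]
    simp_rw [mul_comm]
  have hza : ∫ ω, z 0 ω * a 0 ω ∂P = v := by
    have J1 : Integrable (fun ω => φ₁ * (z (-1) ω * a 0 ω) + φ₂ * (z (-2) ω * a 0 ω)) P :=
      ((Ia _ _).const_mul _).add ((Ia _ _).const_mul _)
    have : ∫ ω, z 0 ω * a 0 ω ∂P =
        ∫ ω, (φ₁ * (z (-1) ω * a 0 ω) + φ₂ * (z (-2) ω * a 0 ω) + a 0 ω ^ 2) ∂P := by
      refine integral_congr_ae ?_
      filter_upwards [hz.recursion 0] with ω hω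
      rw [hω]
      simp only [zero_sub]
      ring
    rw [this, integral_add J1 Iaa, integral_add ((Ia _ _).const_mul _) ((Ia _ _).const_mul _),
      integral_const_mul, integral_const_mul, hz.integral_mul_innovation ha hp (by norm_num),
      hz.integral_mul_innovation ha hp (by norm_num), hz.integral_innovation_sq]
    simp
  have e0 := hexp 0
  have e1 := hexp (-1)
  have e2 := hexp (-2)
  rw [hz.integral_mul_innovation ha hp (by norm_num)] at e1 e2
  rw [hza] at e0
  simp only [hz.integral_mul_eq_acov] at e0 e1 e2
  norm_num [hsymm] at e0 e1 e2
  exact ⟨e1, by linarith, e0⟩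

/-- A vanishing variance would, through the Yule–Walker equations, force the lag-one and lag-two
autocovariances and then σ² to vanish. -/
theorem acov_zero_pos (h2 : φ₁ + φ₂ < 1) (h3 : φ₂ - φ₁ < 1)
    (ha : ∀ t, Measurable (a t))
    (hz : IsStationaryGaussianAR2 P φ₁ φ₂ v z a)
    (hp : ∀ t, AEStronglyMeasurable[pastSigma a t] (z t) P) (hm : UnifMoments P z) :
    0 < acov P z 0 := by
  have h0 : 0 ≤ acov P z 0 := integral_nonneg fun ω => mul_self_nonneg _
  obtain ⟨y1, y2, y3⟩ := hz.yule_walker ha hp hm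
  have hv : (0 : ℝ) < v := hz.variance_pos
  refine lt_of_le_of_ne h0 fun h => ?_
  rw [← h] at y1 y2 y3
  have h4 : (1 - φ₂) * acov P z 1 = 0 := by linarith
  rcases mul_eq_zero.1 h4 with h5 | h5
  · linarith
  · rw [h5] at y2 y3
    rw [y2] at y3
    linarith

/-- The normalised score sums and the normalised centred sum of squared innovations. -/
noncomputable def basis (v : ℝ≥0) (z a : ℤ → Ω → ℝ) (j : Fin 3) (n : ℕ) (ω : Ω) : ℝ :=
  1 / ((n : ℝ) - 2) * ∑ i ∈ Finset.range (n - 2),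
    ![z (i + 2) ω * a (i + 3) ω, z (i + 1) ω * a (i + 3) ω, 1 * (a (i + 3) ω ^ 2 - v)] j

/-- The asymptotic second moments of `basis`. -/
noncomputable def basisCov (v : ℝ≥0) (g₀ g₁ τ : ℝ) : Fin 3 → Fin 3 → ℝ :=
  ![![g₀ * v, g₁ * v, 0], ![g₁ * v, g₀ * v, 0], ![0, 0, τ]]

theorem unifMoments_innovation_sq_sub (hz : IsStationaryGaussianAR2 P φ₁ φ₂ v z a) :
    UnifMoments P fun t ω => a t ω ^ 2 - (v : ℝ) := by
  have ham := hz.unifMoments_innovation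
  simpa [sq] using! (ham.mul ham).sub (UnifMoments.const (v : ℝ))

theorem isIncrement_basis (ha : ∀ t, Measurable (a t))
    (hz : IsStationaryGaussianAR2 P φ₁ φ₂ v z a)
    (hp : ∀ t, AEStronglyMeasurable[pastSigma a t] (z t) P) (hm : UnifMoments P z) (j : Fin 3) :
    IsIncrement P a fun i ω =>
      ![z (i + 2) ω * a (i + 3) ω, z (i + 1) ω * a (i + 3) ω, 1 * (a (i + 3) ω ^ 2 - v)] j := by
  have ham := hz.unifMoments_innovation
  fin_cases j
  · exact isIncrement_mul ha hz.innovation_indep (g := id) continuous_id (fun i => hp _)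
      (hm.comp _) ham hz.integral_innovation
  · exact isIncrement_mul ha hz.innovation_indep (g := id) continuous_id
      (fun i => AEStronglyMeasurable.pastSigma_mono (by omega) (hp _))
      (hm.comp _) ham hz.integral_innovation
  -- The third increment has past factor 1, which is the reason for the factor `1 *` in `basis`.
  · refine isIncrement_mul ha hz.innovation_indep (g := fun x => x ^ 2 - (v : ℝ)) (by fun_prop)
      (fun i => aestronglyMeasurable_const) (UnifMoments.const 1)
      hz.unifMoments_innovation_sq_sub fun t => ?_
    rw [integral_sub (by simpa [sq] using! (ham.mul ham).integrable t) (integrable_const _),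
      hz.integral_innovation_sq]
    simp

theorem eventually_inv_sub_two_le : ∀ᶠ n : ℕ in atTop, |1 / ((n : ℝ) - 2)| ≤ 2 * (n : ℝ) ^ (-1 : ℝ) := by
  filter_upwards [eventually_ge_atTop 4] with n hn
  have h4 : (4 : ℝ) ≤ n := by exact_mod_cast hn
  rw [Real.rpow_neg_one, abs_of_nonneg (by apply div_nonneg <;> linarith), ← div_eq_mul_inv,
    div_le_div_iff₀ (by linarith) (by linarith)]
  linarith

theorem tendsto_div_sub_two : Tendsto (fun n : ℕ => (n : ℝ) * (1 / ((n : ℝ) - 2))) atTop (nhds 1) := by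
  have h1 : Tendsto (fun n : ℕ => 1 + 2 * (1 / ((n : ℝ) - 2))) atTop (nhds (1 + 2 * 0)) := by
    refine (tendsto_const_nhds (x := (1 : ℝ))).add (Tendsto.const_mul 2 ?_)
    simp_rw [one_div]
    exact tendsto_inv_atTop_zero.comp
      (tendsto_atTop_add_const_right _ (-2) tendsto_natCast_atTop_atTop)
  rw [mul_zero, add_zero] at h1
  refine h1.congr' ?_
  filter_upwards [eventually_ge_atTop 3] with n hn
  have h3 : (3 : ℝ) ≤ n := by exact_mod_cast hn
  have : (n : ℝ) - 2 ≠ 0 := by linarith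
  field_simp
  ring

/-- Orthogonality reduces n E(m_j m_k) to n/(n − 2) times the expectation for one index.
Independence from the past evaluates that expectation; the entries mixing a score with a² − σ²
vanish because z is centred. -/
theorem isJetBasis (ha : ∀ t, Measurable (a t))
    (hz : IsStationaryGaussianAR2 P φ₁ φ₂ v z a)
    (hp : ∀ t, AEStronglyMeasurable[pastSigma a t] (z t) P) (hm : UnifMoments P z) :
    IsJetBasis P (basis v z a) (basisCov v (acov P z 0) (acov P z 1)
      (∫ x, (x ^ 2 - (v : ℝ)) ^ 2 ∂gaussianReal 0 v)) := by
  have hinc := hz.isIncrement_basis ha hp hm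
  constructor
  · intro j
    have h0 : MomentO P (fun n ω => ∑ i ∈ Finset.range (n - 2), ![z (i + 2) ω * a (i + 3) ω,
        z (i + 1) ω * a (i + 3) ω, 1 * (a (i + 3) ω ^ 2 - v)] j) (1 / 2) := by
      intro p hp1
      obtain ⟨C, hC, h⟩ := (hinc j).exists_eLpNorm_le p
      refine ⟨C, hC, .of_forall fun n => ⟨((hinc j).memLp_sum _ 0).1, (h (n - 2)).trans ?_⟩⟩
      apply ENNReal.ofReal_le_ofReal
      gcongr
      omega
    refine (h0.seq_mul eventually_inv_sub_two_le).mono (by norm_num)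
  · intro j k
    have hentry : ∀ i : ℕ, ∫ ω,
        ![z (i + 2) ω * a (i + 3) ω, z (i + 1) ω * a (i + 3) ω, 1 * (a (i + 3) ω ^ 2 - v)] j *
        ![z (i + 2) ω * a (i + 3) ω, z (i + 1) ω * a (i + 3) ω, 1 * (a (i + 3) ω ^ 2 - v)] k ∂P =
        basisCov v (acov P z 0) (acov P z 1)
          (∫ x, (x ^ 2 - (v : ℝ)) ^ 2 ∂gaussianReal 0 v) j k := by
      intro i
      have pz : ∀ s : ℤ, s ≤ (i : ℤ) + 2 → AEStronglyMeasurable[pastSigma a (i + 2)] (z s) P :=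
        fun s hs => AEStronglyMeasurable.pastSigma_mono hs (hp s)
      have hsq : ∀ s r : ℤ, s ≤ (i : ℤ) + 2 → r ≤ (i : ℤ) + 2 →
          ∫ ω, (z s ω * a (i + 3) ω) * (z r ω * a (i + 3) ω) ∂P = acov P z (s - r) * v := by
        intro s r hs hr
        have := hz.integral_past_mul ha (t := (i : ℤ) + 3) (g := fun x => x ^ 2) (by omega)
          ((pz s hs).mul (pz r hr)) (by fun_prop)
        rw [hz.integral_innovation_sq] at this
        simp only [Pi.mul_apply] at this
        rw [hz.integral_mul_eq_acov] at this
        rw [← this]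
        congr 1
        ext ω
        ring
      have hcross : ∀ s : ℤ, s ≤ (i : ℤ) + 2 →
          ∫ ω, (z s ω * a (i + 3) ω) * (1 * (a (i + 3) ω ^ 2 - v)) ∂P = 0 := by
        intro s hs
        have := hz.integral_past_mul ha (t := (i : ℤ) + 3) (g := fun x => x * (x ^ 2 - (v : ℝ)))
          (by omega) (pz s hs) (by fun_prop)
        rw [hz.mean_zero, zero_mul] at this
        rw [← this]
        congr 1
        ext ω
        ring
      have hcross' : ∀ s : ℤ, s ≤ (i : ℤ) + 2 →
          ∫ ω, (1 * (a (i + 3) ω ^ 2 - v)) * (z s ω * a (i + 3) ω) ∂P = 0 := by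
        intro s hs
        rw [← hcross s hs]
        simp_rw [mul_comm]
      have hτ : ∫ ω, (1 * (a (i + 3) ω ^ 2 - v)) * (1 * (a (i + 3) ω ^ 2 - v)) ∂P =
          ∫ x, (x ^ 2 - (v : ℝ)) ^ 2 ∂gaussianReal 0 v := by
        rw [← (hz.innovation_law (i + 3)).integral_comp (by fun_prop)]
        congr 1
        ext ω
        simp
        ring
      have hsymm : acov P z (-1) = acov P z 1 := by
        have h1 := hz.integral_mul_eq_acov 0 1
        have h2 := hz.integral_mul_eq_acov 1 0
        norm_num at h1 h2
        rw [← h1, ← h2]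
        simp_rw [mul_comm]
      have s1 : (i : ℤ) + 2 - (i + 1) = 1 := by ring
      have s2 : (i : ℤ) + 1 - (i + 2) = -1 := by ring
      fin_cases j <;> fin_cases k
      · simpa [basisCov] using hsq (i + 2) (i + 2) (by omega) (by omega)
      · simpa [basisCov, s1] using hsq (i + 2) (i + 1) (by omega) (by omega)
      · simpa [basisCov] using hcross (i + 2) (by omega)
      · simpa [basisCov, s2, hsymm] using hsq (i + 1) (i + 2) (by omega) (by omega)
      · simpa [basisCov] using hsq (i + 1) (i + 1) (by omega) (by omega)
      · simpa [basisCov] using hcross (i + 1) (by omega)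
      · simpa [basisCov] using hcross' (i + 2) (by omega)
      · simpa [basisCov] using hcross' (i + 1) (by omega)
      · simpa [basisCov] using hτ
    have hlim := tendsto_div_sub_two.mul_const (basisCov v (acov P z 0) (acov P z 1)
          (∫ x, (x ^ 2 - (v : ℝ)) ^ 2 ∂gaussianReal 0 v) j k)
    rw [one_mul] at hlim
    refine hlim.congr' ?_
    filter_upwards [eventually_ge_atTop 3] with n hn
    have h3 : (3 : ℝ) ≤ n := by exact_mod_cast hn
    have hne : (n : ℝ) - 2 ≠ 0 := by linarith
    have h := (hinc j).integral_sum_mul_sum (hinc k) (n - 2)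
    simp_rw [hentry] at h
    rw [Finset.sum_const, Finset.card_range, nsmul_eq_mul,
      Nat.cast_sub (by omega)] at h
    have e : ∀ ω, basis v z a j n ω * basis v z a k n ω = (1 / ((n : ℝ) - 2) * (1 / ((n : ℝ) - 2))) *
        ((∑ i ∈ Finset.range (n - 2), ![z (i + 2) ω * a (i + 3) ω, z (i + 1) ω * a (i + 3) ω,
          1 * (a (i + 3) ω ^ 2 - v)] j) * (∑ i ∈ Finset.range (n - 2), ![z (i + 2) ω * a (i + 3) ω,
          z (i + 1) ω * a (i + 3) ω, 1 * (a (i + 3) ω ^ 2 - v)] k)) := fun ω => by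
      simp only [basis]
      ring
    simp_rw [e]
    rw [integral_const_mul, h]
    push_cast
    field_simp

end IsStationaryGaussianAR2

/-! ### Jets of the lagged averages. -/

/-- Average of lagged products `z (i + s) * z (i + r)`, `0 ≤ i < n - 2`. -/
noncomputable def avgProd (z : ℤ → Ω → ℝ) (s r : ℤ) (n : ℕ) (ω : Ω) : ℝ :=
  1 / ((n : ℝ) - 2) * ∑ i ∈ Finset.range (n - 2), z (i + s) ω * z (i + r) ω

/-- First-order coefficients of the lag-zero average. -/
noncomputable def coefZero (ρ f : ℝ) : Fin 3 → ℝ :=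
  ![2 * ρ / ((1 - f ^ 2) * (1 - ρ ^ 2)), 2 * f / ((1 - f ^ 2) * (1 - ρ ^ 2)),
    1 / ((1 - f ^ 2) * (1 - ρ ^ 2))]

/-- First-order coefficients of the lag-one averages. -/
noncomputable def coefOne (ρ f : ℝ) : Fin 3 → ℝ := fun i =>
  ρ * coefZero ρ f i + (![1 / (1 - f), 0, 0] : Fin 3 → ℝ) i

/-- First-order coefficients of the lag-two average. -/
noncomputable def coefTwo (ρ f : ℝ) : Fin 3 → ℝ := fun i =>
  (ρ ^ 2 * (1 - f) + f) * coefZero ρ f i + (![ρ, 1, 0] : Fin 3 → ℝ) i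

/-- Shifting the window of an average by one changes it by two end terms over n − 2. -/
theorem momentO_avg_telescope {P : Measure Ω} [IsProbabilityMeasure P] {f : ℕ → Ω → ℝ}
    (hf : UnifMoments P f) :
    MomentO P (fun n ω => 1 / ((n : ℝ) - 2) * ∑ i ∈ Finset.range (n - 2), (f (i + 1) ω - f i ω))
      (-1) := by
  have h := ((hf.momentO fun n => n - 2).sub (hf.momentO fun _ => 0)).seq_mul
    IsStationaryGaussianAR2.eventually_inv_sub_two_le
  rw [zero_add] at h
  refine h.congr (.of_forall fun n => .of_forall fun ω => ?_)
  simp only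
  rw [Finset.sum_range_sub (fun i => f i ω)]

/-- Adding one more term to an average does not change its jet. -/
theorem IsJet.avg_cons {P : Measure Ω} [IsProbabilityMeasure P] {m : Fin 3 → ℕ → Ω → ℝ}
    {S : Fin 3 → Fin 3 → ℝ} (hmb : IsJetBasis P m S) {f : ℕ → Ω → ℝ} (hf : UnifMoments P f) {c : ℝ}
    {l : Fin 3 → ℝ} (hc : ∀ i, ∫ ω, f i ω ∂P = c)
    (h : IsJet P m (fun n ω => 1 / ((n : ℝ) - 2) * ∑ i ∈ Finset.range (n - 2), f (i + 1) ω) c l 0) :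
    IsJet P m (fun n ω => 1 / ((n : ℝ) - 1) * ∑ i ∈ Finset.range (n - 1), f i ω) c l 0 := by
  constructor
  · have hb : ∀ᶠ n : ℕ in atTop, |1 / ((n : ℝ) - 1)| ≤ 2 * (n : ℝ) ^ (-1 : ℝ) := by
      filter_upwards [eventually_ge_atTop 4] with n hn
      have h4 : (4 : ℝ) ≤ n := by exact_mod_cast hn
      rw [Real.rpow_neg_one, abs_of_nonneg (by apply div_nonneg <;> linarith), ← div_eq_mul_inv,
        div_le_div_iff₀ (by linarith) (by linarith)]
      linarith
    -- The longer average minus the shorter one is (f 0 − shorter average)/(n − 1).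
    refine (h.approx.add ((((hf.momentO fun _ => 0).sub (h.momentO hmb)).seq_mul hb).mono
      (by norm_num : (0 + -1 : ℝ) ≤ -1))).congr ?_
    filter_upwards [eventually_ge_atTop 3] with n hn
    refine .of_forall fun ω => ?_
    have h3 : (3 : ℝ) ≤ n := by exact_mod_cast hn
    have h1 : (n : ℝ) - 1 ≠ 0 := by linarith
    have h2 : (n : ℝ) - 2 ≠ 0 := by linarith
    simp only
    rw [show n - 1 = (n - 2) + 1 by omega, Finset.sum_range_succ']
    field_simp
    ring
  · refine tendsto_const_nhds.congr' ?_
    filter_upwards [eventually_ge_atTop 3] with n hn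
    have h3 : (3 : ℝ) ≤ n := by exact_mod_cast hn
    have h1 : (n : ℝ) - 1 ≠ 0 := by linarith
    rw [integral_const_mul, integral_finsetSum _ fun i _ => hf.integrable i]
    simp only [hc, Finset.sum_const, Finset.card_range, nsmul_eq_mul]
    rw [Nat.cast_sub (by omega)]
    push_cast
    field_simp
    ring

namespace IsStationaryGaussianAR2

variable {P : Measure Ω} [IsProbabilityMeasure P] {φ₁ φ₂ : ℝ} {v : ℝ≥0} {z a : ℤ → Ω → ℝ}

omit [IsProbabilityMeasure P] in
theorem unifMoments_prod (hm : UnifMoments P z) (s r : ℤ) :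
    UnifMoments P fun (i : ℕ) ω => z (i + s) ω * z (i + r) ω :=
  (hm.comp fun i : ℕ => (i : ℤ) + s).mul (hm.comp fun i : ℕ => (i : ℤ) + r)

/-- Stationarity makes the average exactly unbiased once n ≥ 3, so lagged averages enter the
calculus with q = 0. -/
theorem tendsto_bias_avgProd (hz : IsStationaryGaussianAR2 P φ₁ φ₂ v z a) (hm : UnifMoments P z)
    (s r : ℤ) : Tendsto (fun n : ℕ => (n : ℝ) * (∫ ω, avgProd z s r n ω ∂P - acov P z (s - r)))
      atTop (nhds 0) := by
  refine tendsto_const_nhds.congr' ?_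
  filter_upwards [eventually_ge_atTop 3] with n hn
  have h3 : (3 : ℝ) ≤ n := by exact_mod_cast hn
  have h1 : (n : ℝ) - 2 ≠ 0 := by linarith
  simp only [avgProd]
  rw [integral_const_mul, integral_finsetSum _ fun i _ => (unifMoments_prod hm s r).integrable i]
  have e : ∀ i : ℕ, (i : ℤ) + s - (i + r) = s - r := fun i => by ring
  simp only [hz.integral_mul_eq_acov, e, Finset.sum_const, Finset.card_range, nsmul_eq_mul]
  rw [Nat.cast_sub (by omega)]
  push_cast
  field_simp
  ring

omit [IsProbabilityMeasure P] in
/-- The sample Yule–Walker equations. -/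
theorem sample_yule_walker (hz : IsStationaryGaussianAR2 P φ₁ φ₂ v z a) {n : ℕ} (hn : 3 ≤ n) :
    ∀ᵐ ω ∂P,
      avgProd z 3 2 n ω = φ₁ * avgProd z 2 2 n ω + φ₂ * avgProd z 2 1 n ω + basis v z a 0 n ω ∧
      avgProd z 3 1 n ω = φ₁ * avgProd z 2 1 n ω + φ₂ * avgProd z 1 1 n ω + basis v z a 1 n ω ∧
      avgProd z 3 3 n ω = φ₁ * avgProd z 3 2 n ω + φ₂ * avgProd z 3 1 n ω + φ₁ * basis v z a 0 n ω +
        φ₂ * basis v z a 1 n ω + basis v z a 2 n ω + v := by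
  have h3 : (3 : ℝ) ≤ n := by exact_mod_cast hn
  have h1 : (n : ℝ) - 2 ≠ 0 := by linarith
  filter_upwards [ae_all_iff.2 fun t => hz.recursion t] with ω hω
  have hrec : ∀ i : ℕ, z (i + 3) ω = φ₁ * z (i + 2) ω + φ₂ * z (i + 1) ω + a (i + 3) ω := fun i => by
    have := hω (i + 3)
    rwa [show (i : ℤ) + 3 - 1 = i + 2 by ring, show (i : ℤ) + 3 - 2 = i + 1 by ring] at this
  have hv : (v : ℝ) = 1 / ((n : ℝ) - 2) * ∑ i ∈ Finset.range (n - 2), (v : ℝ) := by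
    simp only [Finset.sum_const, Finset.card_range, nsmul_eq_mul]
    rw [Nat.cast_sub (by omega)]
    push_cast
    field_simp
  simp only [avgProd, basis, Matrix.cons_val]
  refine ⟨?_, ?_, ?_⟩
  · simp only [Finset.mul_sum, ← Finset.sum_add_distrib]
    refine Finset.sum_congr rfl fun i _ => ?_
    rw [hrec]; ring
  · simp only [Finset.mul_sum, ← Finset.sum_add_distrib]
    refine Finset.sum_congr rfl fun i _ => ?_
    rw [hrec]; ring
  · nth_rewrite 2 [hv]
    simp only [Finset.mul_sum, ← Finset.sum_add_distrib]
    refine Finset.sum_congr rfl fun i _ => ?_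
    rw [hrec]; ring

/-- The autocovariances in terms of the lag-one autocorrelation `φ₁ / (1 - φ₂)`. -/
theorem acov_parametrization (h1 : |φ₂| < 1) (h2 : φ₁ + φ₂ < 1) (h3 : φ₂ - φ₁ < 1)
    (ha : ∀ t, Measurable (a t))
    (hz : IsStationaryGaussianAR2 P φ₁ φ₂ v z a)
    (hp : ∀ t, AEStronglyMeasurable[pastSigma a t] (z t) P) (hm : UnifMoments P z) :
    0 < 1 - φ₂ ∧ 0 < 1 + φ₂ ∧ φ₁ = φ₁ / (1 - φ₂) * (1 - φ₂) ∧ 1 - (φ₁ / (1 - φ₂)) ^ 2 ≠ 0 ∧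
    1 - φ₂ ^ 2 ≠ 0 ∧ acov P z 1 = φ₁ / (1 - φ₂) * acov P z 0 ∧
    acov P z 2 = ((φ₁ / (1 - φ₂)) ^ 2 * (1 - φ₂) + φ₂) * acov P z 0 ∧
    (v : ℝ) = acov P z 0 * ((1 - φ₂ ^ 2) * (1 - (φ₁ / (1 - φ₂)) ^ 2)) := by
  obtain ⟨y1, y2, y3⟩ := hz.yule_walker ha hp hm
  set ρ := φ₁ / (1 - φ₂) with hρ
  rw [abs_lt] at h1
  have hf1 : 0 < 1 - φ₂ := by linarith
  have hf2 : 0 < 1 + φ₂ := by linarith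
  have hφ : φ₁ = ρ * (1 - φ₂) := by rw [hρ]; field_simp
  have hρ1 : ρ < 1 := by rw [hρ, div_lt_one hf1]; linarith
  have hρ2 : -1 < ρ := by rw [hρ, lt_div_iff₀ hf1]; linarith
  have hρ3 : 1 - ρ ^ 2 ≠ 0 := by nlinarith
  have hf3 : 1 - φ₂ ^ 2 ≠ 0 := by nlinarith
  have e1 : acov P z 1 = ρ * acov P z 0 := by
    rw [hρ, div_mul_eq_mul_div, eq_div_iff hf1.ne']; linarith
  have e2 : acov P z 2 = (ρ ^ 2 * (1 - φ₂) + φ₂) * acov P z 0 := by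
    rw [y2, e1, hφ]; ring
  have hv : (v : ℝ) = acov P z 0 * ((1 - φ₂ ^ 2) * (1 - ρ ^ 2)) := by
    have : (v : ℝ) = acov P z 0 - φ₁ * acov P z 1 - φ₂ * acov P z 2 := by linarith
    rw [this, e2, e1, hφ]; ring
  exact ⟨hf1, hf2, hφ, hρ3, hf3, e1, e2, hv⟩

/-- Averages of equal lag agree up to O(1/n), so the sample Yule–Walker equations become three
linear equations for lags 0, 1, 2. Lag 0 is solved for first, the others by substitution. -/
theorem isJet_avgProd (h1 : |φ₂| < 1) (h2 : φ₁ + φ₂ < 1) (h3 : φ₂ - φ₁ < 1)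
    (ha : ∀ t, Measurable (a t))
    (hz : IsStationaryGaussianAR2 P φ₁ φ₂ v z a)
    (hp : ∀ t, AEStronglyMeasurable[pastSigma a t] (z t) P) (hm : UnifMoments P z) :
    IsJet P (basis v z a) (avgProd z 3 3) (acov P z 0) (coefZero (φ₁ / (1 - φ₂)) φ₂) 0 ∧
    IsJet P (basis v z a) (avgProd z 2 2) (acov P z 0) (coefZero (φ₁ / (1 - φ₂)) φ₂) 0 ∧
    IsJet P (basis v z a) (avgProd z 1 1) (acov P z 0) (coefZero (φ₁ / (1 - φ₂)) φ₂) 0 ∧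
    IsJet P (basis v z a) (avgProd z 3 2) (acov P z 1) (coefOne (φ₁ / (1 - φ₂)) φ₂) 0 ∧
    IsJet P (basis v z a) (avgProd z 2 1) (acov P z 1) (coefOne (φ₁ / (1 - φ₂)) φ₂) 0 ∧
    IsJet P (basis v z a) (avgProd z 3 1) (acov P z 2) (coefTwo (φ₁ / (1 - φ₂)) φ₂) 0 := by
  obtain ⟨-, y2, -⟩ := hz.yule_walker ha hp hm
  obtain ⟨hf1, hf2, hφ, hρ3, hf3, e1, e2, hv⟩ := hz.acov_parametrization h1 h2 h3 ha hp hm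
  set ρ := φ₁ / (1 - φ₂) with hρ
  have t1 : MomentO P (fun n ω => avgProd z 3 2 n ω - avgProd z 2 1 n ω) (-1) := by
    refine (momentO_avg_telescope (unifMoments_prod hm 2 1)).congr
      (.of_forall fun n => .of_forall fun ω => ?_)
    simp only [avgProd]
    rw [← mul_sub, ← Finset.sum_sub_distrib]
    congr 1
  have t2 : MomentO P (fun n ω => avgProd z 3 3 n ω - avgProd z 2 2 n ω) (-1) := by
    refine (momentO_avg_telescope (unifMoments_prod hm 2 2)).congr
      (.of_forall fun n => .of_forall fun ω => ?_)
    simp only [avgProd]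
    rw [← mul_sub, ← Finset.sum_sub_distrib]
    congr 1
  have t3 : MomentO P (fun n ω => avgProd z 2 2 n ω - avgProd z 1 1 n ω) (-1) := by
    refine (momentO_avg_telescope (unifMoments_prod hm 1 1)).congr
      (.of_forall fun n => .of_forall fun ω => ?_)
    simp only [avgProd]
    rw [← mul_sub, ← Finset.sum_sub_distrib]
    congr 1
  -- `E1` and `E2` are the errors in the first two sample equations when every average is replaced
  -- by the one of the same lag among `avgProd z 3 3`, `avgProd z 3 2` and `avgProd z 3 1`.
  have E1 := (t2.const_mul (-φ₁)).sub (t1.const_mul φ₂)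
  have E2 := (t1.const_mul (-φ₁)).sub ((t2.add t3).const_mul φ₂)
  have r33 : MomentO P (fun n ω => avgProd z 3 3 n ω - acov P z 0 -
      ∑ i, coefZero ρ φ₂ i * basis v z a i n ω) (-1) := by
    -- The multipliers ρ(1 + φ₂) and φ₂ are those that eliminate lags one and two from the third
    -- equation.
    refine (((E1.const_mul (ρ * (1 + φ₂))).add (E2.const_mul φ₂)).const_mul
      ((1 - φ₂ ^ 2) * (1 - ρ ^ 2))⁻¹).congr ?_
    filter_upwards [eventually_ge_atTop 3] with n hn
    filter_upwards [hz.sample_yule_walker hn] with ω hω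
    obtain ⟨w1, w2, w3⟩ := hω
    simp only [Fin.sum_univ_three, coefZero, Matrix.cons_val]
    rw [inv_mul_eq_iff_eq_mul₀ (mul_ne_zero hf3 hρ3)]
    have hexp : (1 - φ₂ ^ 2) * (1 - ρ ^ 2) * (avgProd z 3 3 n ω - acov P z 0 -
        (2 * ρ / ((1 - φ₂ ^ 2) * (1 - ρ ^ 2)) * basis v z a 0 n ω +
          2 * φ₂ / ((1 - φ₂ ^ 2) * (1 - ρ ^ 2)) * basis v z a 1 n ω +
          1 / ((1 - φ₂ ^ 2) * (1 - ρ ^ 2)) * basis v z a 2 n ω)) =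
        (1 - φ₂ ^ 2) * (1 - ρ ^ 2) * avgProd z 3 3 n ω - v - (2 * ρ * basis v z a 0 n ω +
          2 * φ₂ * basis v z a 1 n ω + basis v z a 2 n ω) := by
      rw [hv]; field_simp
    rw [hexp]
    rw [hφ] at w1 w2 w3 ⊢
    linear_combination (-ρ * (1 + φ₂)) * w1 - φ₂ * w2 - w3
  have r32 : MomentO P (fun n ω => avgProd z 3 2 n ω - acov P z 1 -
      ∑ i, coefOne ρ φ₂ i * basis v z a i n ω) (-1) := by
    refine ((r33.const_mul ρ).add (E1.const_mul (1 - φ₂)⁻¹)).congr ?_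
    filter_upwards [eventually_ge_atTop 3] with n hn
    filter_upwards [hz.sample_yule_walker hn] with ω hω
    obtain ⟨w1, w2, w3⟩ := hω
    simp only [Fin.sum_univ_three, coefOne, Matrix.cons_val]
    rw [e1]
    rw [hφ] at w1 ⊢
    field_simp
    linear_combination (-1) * w1
  have r31 : MomentO P (fun n ω => avgProd z 3 1 n ω - acov P z 2 -
      ∑ i, coefTwo ρ φ₂ i * basis v z a i n ω) (-1) := by
    refine (((r32.const_mul φ₁).add (r33.const_mul φ₂)).add E2).congr ?_
    filter_upwards [eventually_ge_atTop 3] with n hn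
    filter_upwards [hz.sample_yule_walker hn] with ω hω
    obtain ⟨w1, w2, w3⟩ := hω
    simp only [Fin.sum_univ_three, coefOne, coefTwo, Matrix.cons_val]
    rw [y2]
    rw [hφ] at w2 ⊢
    field_simp
    linear_combination (-1) * w2
  have b := hz.tendsto_bias_avgProd hm
  refine ⟨⟨r33, b 3 3⟩, ⟨(r33.sub t2).congr ?_, b 2 2⟩, ⟨((r33.sub t2).sub t3).congr ?_, b 1 1⟩,
    ⟨r32, b 3 2⟩, ⟨(r32.sub t1).congr ?_, b 2 1⟩, ⟨r31, b 3 1⟩⟩ <;>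
  exact .of_forall fun n => .of_forall fun ω => by ring

end IsStationaryGaussianAR2

theorem MomentO.eventually_aestronglyMeasurable {P : Measure Ω} {X : ℕ → Ω → ℝ} {r : ℝ}
    (hX : MomentO P X r) : ∀ᶠ n in atTop, AEStronglyMeasurable (X n) P := by
  obtain ⟨C, -, h⟩ := hX 1 le_rfl
  exact h.mono fun n hn => hn.1

theorem sum_Icc_eq_sum_range (g : ℤ → ℝ) (k : ℤ) (N : ℕ) {n : ℤ} (hn : n + 1 = k + N) :
    ∑ t ∈ Finset.Icc k n, g t = ∑ i ∈ Finset.range N, g (i + k) := by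
  refine Finset.sum_nbij' (fun t => (t - k).toNat) (fun i => (i : ℤ) + k) ?_ ?_ ?_ ?_ ?_
  · intro t ht; simp only [Finset.mem_Icc, Finset.mem_range] at *; omega
  · intro t ht; simp only [Finset.mem_Icc, Finset.mem_range] at *; omega
  · intro t ht; simp only [Finset.mem_Icc] at *; omega
  · intro t ht; simp
  · intro t ht
    simp only [Finset.mem_Icc] at ht
    congr 1
    omega

/-! ### Pointwise bounds and identities for the Burg estimators. -/

section BurgBounds

variable {n : ℕ} (x : ℤ → ℝ)

/-- D − 2F and D + 2F are averages of the squares (x_t ∓ x_{t-1})². -/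
theorem abs_two_mul_statF_le (hn : 3 ≤ n) : |2 * statF n x| ≤ statD n x := by
  have h3 : (3 : ℝ) ≤ n := by exact_mod_cast hn
  have h1 : 0 ≤ 1 / ((n : ℝ) - 1) := by apply div_nonneg <;> linarith
  have e1 : statD n x - 2 * statF n x =
      1 / ((n : ℝ) - 1) * ∑ t ∈ Finset.Icc (2 : ℤ) n, (x t - x (t - 1)) ^ 2 := by
    simp only [statD, statF, Finset.mul_sum, ← Finset.sum_sub_distrib]
    exact Finset.sum_congr rfl fun t _ => by ring
  have e2 : statD n x + 2 * statF n x =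
      1 / ((n : ℝ) - 1) * ∑ t ∈ Finset.Icc (2 : ℤ) n, (x t + x (t - 1)) ^ 2 := by
    simp only [statD, statF, Finset.mul_sum, ← Finset.sum_add_distrib]
    exact Finset.sum_congr rfl fun t _ => by ring
  have n1 : 0 ≤ statD n x - 2 * statF n x := by
    rw [e1]; exact mul_nonneg h1 (Finset.sum_nonneg fun _ _ => sq_nonneg _)
  have n2 : 0 ≤ statD n x + 2 * statF n x := by
    rw [e2]; exact mul_nonneg h1 (Finset.sum_nonneg fun _ _ => sq_nonneg _)
  rw [abs_le]
  constructor <;> linarith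

theorem abs_two_mul_statF_div_le (hn : 3 ≤ n) : |2 * statF n x / statD n x| ≤ 1 := by
  have h := abs_two_mul_statF_le x hn
  rw [abs_div]
  exact div_le_one_of_le₀ (h.trans (le_abs_self _)) (abs_nonneg _)

theorem two_mul_statF_div_mul (hn : 3 ≤ n) :
    2 * statF n x / statD n x * statD n x = 2 * statF n x := by
  rcases eq_or_ne (statD n x) 0 with h | h
  · have h1 := abs_two_mul_statF_le x hn
    rw [h] at h1 ⊢
    simp [abs_nonpos_iff.1 h1]
  · field_simp

/-- The numerator of one minus the Burg estimate lies between zero and twice the denominator. -/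
theorem burg_num_bounds (hn : 3 ≤ n) :
    0 ≤ statC n x * statD n x ^ 2 - 2 * statE n x * statD n x ^ 2 ∧
    statC n x * statD n x ^ 2 - 2 * statE n x * statD n x ^ 2 ≤
      2 * (statC n x * statD n x ^ 2 + 8 * statF n x ^ 2 * statG n x
        - 4 * statF n x * statH n x * statD n x) := by
  have h3 : (3 : ℝ) ≤ n := by exact_mod_cast hn
  have h1 : 0 ≤ 1 / ((n : ℝ) - 2) := by apply div_nonneg <;> linarith
  -- D and F act as free parameters here: both gaps are sums of squares whatever their values.
  generalize statD n x = d
  generalize statF n x = f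
  have e1 : statC n x * d ^ 2 - 2 * statE n x * d ^ 2 =
      1 / ((n : ℝ) - 2) * ∑ t ∈ Finset.Icc (3 : ℤ) n, (d * (x t - x (t - 2))) ^ 2 := by
    simp only [statC, statE, Finset.mul_sum, Finset.sum_mul, ← Finset.sum_sub_distrib]
    exact Finset.sum_congr rfl fun t _ => by ring
  have e2 : 2 * (statC n x * d ^ 2 + 8 * f ^ 2 * statG n x - 4 * f * statH n x * d) -
      (statC n x * d ^ 2 - 2 * statE n x * d ^ 2) =
      1 / ((n : ℝ) - 2) * ∑ t ∈ Finset.Icc (3 : ℤ) n,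
        (d * (x t + x (t - 2)) - 4 * f * x (t - 1)) ^ 2 := by
    simp only [statC, statE, statG, statH, Finset.mul_sum, Finset.sum_mul,
      ← Finset.sum_sub_distrib, ← Finset.sum_add_distrib]
    exact Finset.sum_congr rfl fun t _ => by ring
  constructor
  · rw [e1]; exact mul_nonneg h1 (Finset.sum_nonneg fun _ _ => sq_nonneg _)
  · rw [← sub_nonneg, e2]; exact mul_nonneg h1 (Finset.sum_nonneg fun _ _ => sq_nonneg _)

theorem abs_one_sub_burgPhi2_le (hn : 3 ≤ n) : |1 - burgPhi2 n x| ≤ 2 := by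
  obtain ⟨h1, h2⟩ := burg_num_bounds x hn
  rw [burgPhi2, sub_sub_cancel, abs_of_nonneg (div_nonneg h1 (by linarith))]
  exact div_le_of_le_mul₀ (by linarith) (by norm_num) h2

/-- This is the definition with D² divided out, written in K = 2F/D, so that the jet calculus
divides twice by simple quantities. It survives the degenerate cases: D = 0 makes all observations
vanish, and a zero denominator squeezes the numerator to 0. -/
theorem one_sub_burgPhi2_mul (hn : 3 ≤ n) :
    (1 - burgPhi2 n x) * (statC n x - 2 * (2 * statF n x / statD n x * statH n x) +
      2 * (2 * statF n x / statD n x * (2 * statF n x / statD n x * statG n x))) =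
      statC n x - 2 * statE n x := by
  have h3 : (3 : ℝ) ≤ n := by exact_mod_cast hn
  rcases eq_or_ne (statD n x) 0 with h | h
  · have h0 : ∀ t ∈ Finset.Icc (2 : ℤ) n, x t ^ 2 + x (t - 1) ^ 2 = 0 := by
      rw [statD, mul_eq_zero] at h
      rcases h with h | h
      · exact absurd h (one_div_ne_zero (by linarith))
      · exact (Finset.sum_eq_zero_iff_of_nonneg fun t _ => by positivity).1 h
    have h1 : ∀ t ∈ Finset.Icc (3 : ℤ) n, x t = 0 ∧ x (t - 1) = 0 ∧ x (t - 2) = 0 := by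
      intro t ht
      rw [Finset.mem_Icc] at ht
      have a1 := h0 t (Finset.mem_Icc.2 (by omega))
      have a2 := h0 (t - 1) (Finset.mem_Icc.2 (by omega))
      rw [show t - 1 - 1 = t - 2 by ring] at a2
      refine ⟨?_, ?_, ?_⟩ <;> refine pow_eq_zero_iff two_ne_zero |>.1 ?_ <;> nlinarith
    have hC : statC n x = 0 := by
      rw [statC, Finset.sum_eq_zero fun t ht => by rw [(h1 t ht).1, (h1 t ht).2.2]; ring, mul_zero]
    have hE : statE n x = 0 := by
      rw [statE, Finset.sum_eq_zero fun t ht => by rw [(h1 t ht).1]; ring, mul_zero]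
    have hG : statG n x = 0 := by
      rw [statG, Finset.sum_eq_zero fun t ht => by rw [(h1 t ht).2.1]; ring, mul_zero]
    have hH : statH n x = 0 := by
      rw [statH, Finset.sum_eq_zero fun t ht => by rw [(h1 t ht).2.1]; ring, mul_zero]
    simp [hC, hE, hG, hH]
  · have hY : (1 - burgPhi2 n x) * (statC n x * statD n x ^ 2 + 8 * statF n x ^ 2 * statG n x
        - 4 * statF n x * statH n x * statD n x) =
        statC n x * statD n x ^ 2 - 2 * statE n x * statD n x ^ 2 := by
      obtain ⟨h1, h2⟩ := burg_num_bounds x hn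
      rw [burgPhi2, sub_sub_cancel]
      rcases eq_or_ne (statC n x * statD n x ^ 2 + 8 * statF n x ^ 2 * statG n x
        - 4 * statF n x * statH n x * statD n x) 0 with h0 | h0
      · rw [h0] at h2 ⊢
        linarith
      · exact div_mul_cancel₀ _ h0
    refine mul_right_cancel₀ (pow_ne_zero 2 h) ?_
    calc _ = (1 - burgPhi2 n x) * (statC n x * statD n x ^ 2 + 8 * statF n x ^ 2 * statG n x
        - 4 * statF n x * statH n x * statD n x) := by field_simp; ring
      _ = _ := by rw [hY]; ring

end BurgBounds

/-! ### Least squares: normal equations and the inverse Gram determinant. -/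

/-- The normal equations of the least-squares problem. -/
theorem IsLeastSquaresAR2.normal_equations {n : ℕ} {x : ℤ → ℝ} {b₁ b₂ : ℝ}
    (h : IsLeastSquaresAR2 n x b₁ b₂) :
    ∑ t ∈ Finset.Icc (3 : ℤ) n, x (t - 1) * (x t - b₁ * x (t - 1) - b₂ * x (t - 2)) = 0 ∧
    ∑ t ∈ Finset.Icc (3 : ℤ) n, x (t - 2) * (x t - b₁ * x (t - 1) - b₂ * x (t - 2)) = 0 := by
  have key : ∀ s u : ℝ, 0 ≤ u → (∀ e : ℝ, 0 ≤ -2 * e * s + e ^ 2 * u) → s = 0 := by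
    intro s u hu hs
    -- The increment s/(u + 1), instead of the optimal s/u, avoids the case u = 0.
    have h1 := hs (s / (u + 1))
    have h2 : (u + 1) ≠ 0 := by linarith
    have h3 : -2 * (s / (u + 1)) * s + (s / (u + 1)) ^ 2 * u =
        -(s ^ 2 * (u + 2) / (u + 1) ^ 2) := by field_simp; ring
    rw [h3, Left.nonneg_neg_iff] at h1
    by_contra hne
    have : 0 < s ^ 2 * (u + 2) / (u + 1) ^ 2 := by positivity
    linarith
  constructor
  · refine key _ (∑ t ∈ Finset.Icc (3 : ℤ) n, x (t - 1) ^ 2)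
      (Finset.sum_nonneg fun _ _ => sq_nonneg _) fun e => ?_
    have := h (b₁ + e) b₂
    rw [← sub_nonneg] at this
    refine this.trans_eq ?_
    simp only [residualSS, Finset.mul_sum, ← Finset.sum_sub_distrib, ← Finset.sum_add_distrib]
    exact Finset.sum_congr rfl fun t _ => by ring
  · refine key _ (∑ t ∈ Finset.Icc (3 : ℤ) n, x (t - 2) ^ 2)
      (Finset.sum_nonneg fun _ _ => sq_nonneg _) fun e => ?_
    have := h b₁ (b₂ + e)
    rw [← sub_nonneg] at this
    refine this.trans_eq ?_
    simp only [residualSS, Finset.mul_sum, ← Finset.sum_sub_distrib, ← Finset.sum_add_distrib]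
    exact Finset.sum_congr rfl fun t _ => by ring

namespace IsStationaryGaussianAR2

variable {P : Measure Ω} [IsProbabilityMeasure P] {φ₁ φ₂ : ℝ} {v : ℝ≥0} {z a : ℤ → Ω → ℝ}

/-- Determinant of the Gram matrix of the regressors. -/
abbrev gramDet (z : ℤ → Ω → ℝ) (n : ℕ) (ω : Ω) : ℝ :=
  (∑ i ∈ Finset.range (n - 2), z (i + 2) ω ^ 2) * (∑ i ∈ Finset.range (n - 2), z (i + 1) ω ^ 2) -
    (∑ i ∈ Finset.range (n - 2), z (i + 2) ω * z (i + 1) ω) ^ 2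

omit [MeasurableSpace Ω] in
-- The kth minor uses the rows with indices 3k and 3k + 1 of the design, and its square is at most
-- the Gram determinant.
theorem sq_prod_minor_le {m n : ℕ} (hn : 3 * m + 2 ≤ n) (ω : Ω) :
    (∏ k ∈ Finset.range m, minor z (3 * k) ω) ^ 2 ≤ gramDet z n ω ^ m := by
  rw [← Finset.prod_pow]
  refine (Finset.prod_le_prod (g := fun _ => gramDet z n ω) (fun _ _ => sq_nonneg _)
    fun k hk => ?_).trans_eq (by simp)
  rw [Finset.mem_range] at hk
  have := sq_minor_le_gram (Finset.range (n - 2)) (fun i : ℕ => z (i + 2) ω)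
    (fun i : ℕ => z (i + 1) ω) (i := 3 * k) (j := 3 * k + 1)
    (Finset.mem_range.2 (by omega)) (Finset.mem_range.2 (by omega)) (by omega)
  refine le_trans (le_of_eq ?_) this
  push_cast
  rw [show (3 * (k : ℤ) + 1 + 1) = 3 * k + 2 by ring, show (3 * (k : ℤ) + 1 + 2) = 3 * k + 3 by ring]
  simp only [minor]
  ring

omit [MeasurableSpace Ω] in
-- With 4p minors, |product| ≤ |det|^{2p}; so integrability of the product to the power −1/2 yields
-- the moment of order −p of the determinant.
theorem enorm_inv_gramDet_rpow_le {p n : ℕ} (hn : 3 * (4 * p) + 2 ≤ n) (ω : Ω) :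
    ‖(gramDet z n ω)⁻¹‖ₑ ^ (p : ℝ) ≤
      ‖∏ k ∈ Finset.range (4 * p), minor z (3 * k) ω‖ₑ ^ (-1 / 2 : ℝ) := by
  have h := sq_prod_minor_le (z := z) hn ω
  generalize ∏ k ∈ Finset.range (4 * p), minor z (3 * k) ω = D at *
  generalize gramDet z n ω = g at *
  have h1 : |D| ≤ |g| ^ (2 * p) := by
    refine abs_le_of_sq_le_sq ?_ (by positivity)
    rw [← pow_mul, show 2 * p * 2 = 4 * p by ring]
    rwa [(show Even (4 * p) from ⟨2 * p, by ring⟩).pow_abs]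
  have h2 : ‖D‖ₑ ≤ ‖g‖ₑ ^ (2 * p) := by
    rw [← ofReal_norm, ← ofReal_norm, ← ENNReal.ofReal_pow (norm_nonneg _)]
    exact ENNReal.ofReal_le_ofReal h1
  have h3 : ‖D‖ₑ ^ (1 / 2 : ℝ) ≤ ‖g‖ₑ ^ (p : ℝ) := by
    refine (ENNReal.rpow_le_rpow h2 (by norm_num)).trans_eq ?_
    rw [← ENNReal.rpow_natCast, ← ENNReal.rpow_mul]
    congr 1
    push_cast
    ring
  have h4 : ‖g⁻¹‖ₑ ≤ ‖g‖ₑ⁻¹ := by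
    rcases eq_or_ne g 0 with rfl | h0
    · simp
    · rw [enorm_inv h0]
  calc ‖g⁻¹‖ₑ ^ (p : ℝ) ≤ (‖g‖ₑ⁻¹) ^ (p : ℝ) := ENNReal.rpow_le_rpow h4 (by positivity)
    _ = (‖g‖ₑ ^ (p : ℝ))⁻¹ := ENNReal.inv_rpow _ _
    _ ≤ (‖D‖ₑ ^ (1 / 2 : ℝ))⁻¹ := ENNReal.inv_le_inv.2 h3
    _ = ‖D‖ₑ ^ (-1 / 2 : ℝ) := by rw [← ENNReal.rpow_neg, neg_div]

theorem momentO_inv_gramDet (ha : ∀ t, Measurable (a t))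
    (hz : IsStationaryGaussianAR2 P φ₁ φ₂ v z a)
    (hp : ∀ t, AEStronglyMeasurable[pastSigma a t] (z t) P) :
    MomentO P (fun n ω => (gramDet z n ω)⁻¹) 0 := by
  intro p hp1
  have hfin := hz.lintegral_prod_minor_lt_top ha hp (4 * p)
  set L := ∫⁻ ω, ‖∏ k ∈ Finset.range (4 * p), minor z (3 * k) ω‖ₑ ^ (-1 / 2 : ℝ) ∂P with hL
  have hLtop : L ^ (1 / (p : ℝ)) ≠ ⊤ := ENNReal.rpow_ne_top_of_nonneg (by positivity) hfin.ne
  refine ⟨(L ^ (1 / (p : ℝ))).toReal, ENNReal.toReal_nonneg, ?_⟩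
  -- The number of observations needed grows with p, which `MomentO` permits.
  filter_upwards [eventually_ge_atTop (3 * (4 * p) + 2)] with n hn
  have hzm : ∀ t, AEMeasurable (z t) P := fun t => (hz.memLp t).1.aemeasurable
  constructor
  · refine AEMeasurable.aestronglyMeasurable ?_
    exact (((Finset.aemeasurable_fun_sum _ fun i _ => (hzm _).pow_const 2).mul
      (Finset.aemeasurable_fun_sum _ fun i _ => (hzm _).pow_const 2)).sub
      ((Finset.aemeasurable_fun_sum _ fun i _ => (hzm _).mul (hzm _)).pow_const 2)).inv
  · rw [Real.rpow_zero, mul_one, ENNReal.ofReal_toReal hLtop,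
      eLpNorm_eq_lintegral_rpow_enorm_toReal (by simp; omega) (ENNReal.natCast_ne_top p)]
    rw [ENNReal.toReal_natCast]
    exact ENNReal.rpow_le_rpow (lintegral_mono fun ω => enorm_inv_gramDet_rpow_le hn ω)
      (by positivity)

theorem ae_gramDet_ne_zero (ha : ∀ t, Measurable (a t))
    (hz : IsStationaryGaussianAR2 P φ₁ φ₂ v z a)
    (hp : ∀ t, AEStronglyMeasurable[pastSigma a t] (z t) P) {n : ℕ} (hn : 5 ≤ n) :
    ∀ᵐ ω ∂P, gramDet z n ω ≠ 0 := by
  have hfin := hz.lintegral_prod_minor_lt_top ha hp 1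
  have hzm : ∀ t, AEMeasurable (z t) P := fun t => (hz.memLp t).1.aemeasurable
  have hm : AEMeasurable (fun ω =>
      ‖∏ k ∈ Finset.range 1, minor z (3 * (k : ℕ)) ω‖ₑ ^ (-1 / 2 : ℝ)) P := by
    simp only [Finset.range_one, Finset.prod_singleton, minor]
    exact ((((hzm _).pow_const 2).sub ((hzm _).mul (hzm _))).enorm).pow_const _
  filter_upwards [ae_lt_top' hm hfin.ne] with ω hω h0
  have h1 := sq_prod_minor_le (z := z) (m := 1) (by omega : 3 * 1 + 2 ≤ n) ω
  rw [h0] at h1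
  have h2 : ∏ k ∈ Finset.range 1, minor z (3 * (k : ℕ)) ω = 0 := by
    refine pow_eq_zero_iff two_ne_zero |>.1 (le_antisymm (by simpa using h1) (sq_nonneg _))
  rw [h2, enorm_zero, ENNReal.zero_rpow_of_neg (by norm_num)] at hω
  exact lt_irrefl _ hω

end IsStationaryGaussianAR2

/-! ### The biases. -/

namespace IsStationaryGaussianAR2

variable {P : Measure Ω} [IsProbabilityMeasure P] {φ₁ φ₂ : ℝ} {v : ℝ≥0} {z a : ℤ → Ω → ℝ}

theorem isJet_basis (ha : ∀ t, Measurable (a t))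
    (hz : IsStationaryGaussianAR2 P φ₁ φ₂ v z a)
    (hp : ∀ t, AEStronglyMeasurable[pastSigma a t] (z t) P) (hm : UnifMoments P z) (j : Fin 3) :
    IsJet P (basis v z a) (basis v z a j) 0 (Pi.single j 1) 0 := by
  constructor
  · refine (IsJet.const (P := P) (m := basis v z a) 0).approx.congr
      (.of_forall fun n => .of_forall fun ω => ?_)
    simp [Pi.single_apply]
  · refine tendsto_const_nhds.congr fun n => ?_
    have hinc := hz.isIncrement_basis ha hp hm j
    have h : ∫ ω, basis v z a j n ω ∂P = 0 := by
      simp only [basis]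
      rw [integral_const_mul, integral_finsetSum _ fun i _ => hinc.moments.integrable i,
        Finset.sum_eq_zero, mul_zero]
      intro i _
      simpa using hinc.orth i (fun _ => 1) aestronglyMeasurable_const fun p => memLp_const 1
    rw [h]
    simp

/-- Jets of the statistics entering the Burg estimators. -/
theorem isJet_stats (h1 : |φ₂| < 1) (h2 : φ₁ + φ₂ < 1) (h3 : φ₂ - φ₁ < 1)
    (ha : ∀ t, Measurable (a t))
    (hz : IsStationaryGaussianAR2 P φ₁ φ₂ v z a)
    (hp : ∀ t, AEStronglyMeasurable[pastSigma a t] (z t) P) (hm : UnifMoments P z) :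
    IsJet P (basis v z a) (fun n ω => statC n fun t => z t ω) (2 * acov P z 0)
      (fun i => 2 * coefZero (φ₁ / (1 - φ₂)) φ₂ i) 0 ∧
    IsJet P (basis v z a) (fun n ω => statD n fun t => z t ω) (2 * acov P z 0)
      (fun i => 2 * coefZero (φ₁ / (1 - φ₂)) φ₂ i) 0 ∧
    IsJet P (basis v z a) (fun n ω => statE n fun t => z t ω) (acov P z 2)
      (coefTwo (φ₁ / (1 - φ₂)) φ₂) 0 ∧
    IsJet P (basis v z a) (fun n ω => statF n fun t => z t ω) (acov P z 1)
      (coefOne (φ₁ / (1 - φ₂)) φ₂) 0 ∧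
    IsJet P (basis v z a) (fun n ω => statG n fun t => z t ω) (acov P z 0)
      (coefZero (φ₁ / (1 - φ₂)) φ₂) 0 ∧
    IsJet P (basis v z a) (fun n ω => statH n fun t => z t ω) (2 * acov P z 1)
      (fun i => 2 * coefOne (φ₁ / (1 - φ₂)) φ₂ i) 0 := by
  have hb := hz.isJetBasis ha hp hm
  obtain ⟨j33, j22, j11, j32, j21, j31⟩ := hz.isJet_avgProd h1 h2 h3 ha hp hm
  have h3s : ∀ n : ℕ, 3 ≤ n → ∀ g : ℤ → ℝ, ∑ t ∈ Finset.Icc (3 : ℤ) n, g t =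
      ∑ i ∈ Finset.range (n - 2), g (i + 3) := fun n hn g =>
    sum_Icc_eq_sum_range g 3 (n - 2) (by omega)
  have h2s : ∀ n : ℕ, 3 ≤ n → ∀ g : ℤ → ℝ, ∑ t ∈ Finset.Icc (2 : ℤ) n, g t =
      ∑ i ∈ Finset.range (n - 1), g (i + 2) := fun n hn g =>
    sum_Icc_eq_sum_range g 2 (n - 1) (by omega)
  have s1 : ∀ i : ℤ, i + 3 - 1 = i + 2 := fun i => by ring
  have s2 : ∀ i : ℤ, i + 3 - 2 = i + 1 := fun i => by ring
  have s3 : ∀ i : ℤ, i + 2 - 1 = i + 1 := fun i => by ring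
  have s4 : ∀ i : ℤ, i + 1 + 2 = i + 3 := fun i => by ring
  have s5 : ∀ i : ℤ, i + 1 + 1 = i + 2 := fun i => by ring
  have jC : IsJet P (basis v z a) (fun n ω => statC n fun t => z t ω) (2 * acov P z 0)
      (fun i => 2 * coefZero (φ₁ / (1 - φ₂)) φ₂ i) 0 := by
    have h := j33.add hb j11
    simp only [← two_mul, mul_zero] at h
    refine h.congr ?_
    filter_upwards [eventually_ge_atTop 3] with n hn
    refine .of_forall fun ω => ?_
    simp only [statC, avgProd, h3s n hn, s2, Finset.mul_sum, ← Finset.sum_add_distrib]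
    exact Finset.sum_congr rfl fun i _ => by ring
  have jE : IsJet P (basis v z a) (fun n ω => statE n fun t => z t ω) (acov P z 2)
      (coefTwo (φ₁ / (1 - φ₂)) φ₂) 0 := by
    refine j31.congr ?_
    filter_upwards [eventually_ge_atTop 3] with n hn
    refine .of_forall fun ω => ?_
    simp only [statE, avgProd, h3s n hn, s2]
  have jG : IsJet P (basis v z a) (fun n ω => statG n fun t => z t ω) (acov P z 0)
      (coefZero (φ₁ / (1 - φ₂)) φ₂) 0 := by
    refine j22.congr ?_
    filter_upwards [eventually_ge_atTop 3] with n hn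
    refine .of_forall fun ω => ?_
    simp only [statG, avgProd, h3s n hn, s1, sq]
  have jH : IsJet P (basis v z a) (fun n ω => statH n fun t => z t ω) (2 * acov P z 1)
      (fun i => 2 * coefOne (φ₁ / (1 - φ₂)) φ₂ i) 0 := by
    have h := j32.add hb j21
    simp only [← two_mul, mul_zero] at h
    refine h.congr ?_
    filter_upwards [eventually_ge_atTop 3] with n hn
    refine .of_forall fun ω => ?_
    simp only [statH, avgProd, h3s n hn, s1, s2, Finset.mul_sum, ← Finset.sum_add_distrib]
    exact Finset.sum_congr rfl fun i _ => by ring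
  have hI := fun (s r : ℤ) (i : ℕ) => (unifMoments_prod hm s r).integrable i
  have hcov : ∀ (i : ℕ) (s r : ℤ), ∫ ω, z (i + s) ω * z (i + r) ω ∂P = acov P z (s - r) :=
    fun i s r => by
      rw [hz.integral_mul_eq_acov]
      congr 1
      ring
  have jF : IsJet P (basis v z a) (fun n ω => statF n fun t => z t ω) (acov P z 1)
      (coefOne (φ₁ / (1 - φ₂)) φ₂) 0 := by
    have h := IsJet.avg_cons hb (unifMoments_prod hm 2 1) (c := acov P z 1)
      (l := coefOne (φ₁ / (1 - φ₂)) φ₂) (fun i => hcov i 2 1) (j32.congr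
        (.of_forall fun n => .of_forall fun ω => by
          simp only [avgProd]; push_cast; simp only [s4, s5]))
    refine h.congr ?_
    filter_upwards [eventually_ge_atTop 3] with n hn
    refine .of_forall fun ω => ?_
    simp only [statF, h2s n hn, s3]
  have jD : IsJet P (basis v z a) (fun n ω => statD n fun t => z t ω) (2 * acov P z 0)
      (fun i => 2 * coefZero (φ₁ / (1 - φ₂)) φ₂ i) 0 := by
    have h0 := j33.add hb j22
    simp only [← two_mul, mul_zero] at h0
    have h := IsJet.avg_cons hb ((unifMoments_prod hm 2 2).add (unifMoments_prod hm 1 1))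
      (c := 2 * acov P z 0)
      (l := fun i => 2 * coefZero (φ₁ / (1 - φ₂)) φ₂ i) (fun i => by
        rw [integral_add (hI 2 2 i) (hI 1 1 i), hcov, hcov]
        norm_num
        ring) (h0.congr
        (.of_forall fun n => .of_forall fun ω => by
          simp only [avgProd, Finset.sum_add_distrib, mul_add]; push_cast; simp only [s4, s5]))
    refine h.congr ?_
    filter_upwards [eventually_ge_atTop 3] with n hn
    refine .of_forall fun ω => ?_
    simp only [statD, h2s n hn, s3, sq]
  exact ⟨jC, jD, jE, jF, jG, jH⟩

/-- With K = 2F/D one has 1 − φ̂₂ = (C − 2E)/(C − 2KH + 2K²G), outside degenerate cases, and φ̂₁ =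
K(1 − φ̂₂). Two divisions, each with a bounded quotient, and one product give both jets. -/
theorem burg_hasBias (h1 : |φ₂| < 1) (h2 : φ₁ + φ₂ < 1) (h3 : φ₂ - φ₁ < 1)
    (ha : ∀ t, Measurable (a t)) (hz : IsStationaryGaussianAR2 P φ₁ φ₂ v z a) :
    HasBiasToOrderInv P (fun n ω => burgPhi1 n (fun t => z t ω)) φ₁ (-φ₁) ∧
      HasBiasToOrderInv P (fun n ω => burgPhi2 n (fun t => z t ω)) φ₂ (-(1 + 3 * φ₂)) := by
  obtain ⟨hp, hm⟩ := hz.past_and_moments h1 h2 h3 ha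
  have hb := hz.isJetBasis ha hp hm
  obtain ⟨jC, jD, jE, jF, jG, jH⟩ := hz.isJet_stats h1 h2 h3 ha hp hm
  have hg := hz.acov_zero_pos h2 h3 ha hp hm
  obtain ⟨hf1, hf2, hφ, hρ3, hf3, e1, e2, hv⟩ := hz.acov_parametrization h1 h2 h3 ha hp hm
  set ρ := φ₁ / (1 - φ₂) with hρ
  -- Its value is irrelevant: K and 1 − φ̂₂ have no component along the third basis element.
  generalize (∫ x, (x ^ 2 - (v : ℝ)) ^ 2 ∂gaussianReal 0 v) = τ at hb
  have hform : ∀ l k : Fin 3 → ℝ, jetForm (basisCov v (acov P z 0) (acov P z 1) τ) l k =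
      acov P z 0 ^ 2 * ((1 - φ₂ ^ 2) * (1 - ρ ^ 2)) * (l 0 * k 0 + l 1 * k 1 +
        ρ * (l 0 * k 1 + l 1 * k 0)) + τ * (l 2 * k 2) := by
    intro l k
    simp only [jetForm, basisCov, Fin.sum_univ_three, Matrix.cons_val, hv, e1]
    ring
  rw [e1] at jF jH
  rw [e2] at jE
  set g := acov P z 0 with hgdef
  generalize hS : basisCov v g (acov P z 1) τ = S at hb hform
  have hn3 : ∀ᶠ n : ℕ in atTop, 3 ≤ n := eventually_ge_atTop 3
  have mF := (jF.momentO hb).eventually_aestronglyMeasurable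
  have mD := (jD.momentO hb).eventually_aestronglyMeasurable
  have jK : IsJet P (basis v z a) (fun n ω => 2 * statF n (fun t => z t ω) / statD n (fun t => z t ω))
      ρ ![1 / (g * (1 - φ₂)), 0, 0] (-2 * ρ * (1 + φ₂) / (1 - φ₂)) := by
    have h2F := jF.const_mul 2
    rw [show 2 * (ρ * g) = ρ * (2 * g) by ring] at h2F
    have hK : MomentO P (fun n ω => 2 * statF n (fun t => z t ω) / statD n (fun t => z t ω)) 0 := by
      refine MomentO.of_abs_le (C := 1) ?_ ?_
      · filter_upwards [mF, mD] with n h1 h2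
        exact ((h1.aemeasurable.const_mul 2).div h2.aemeasurable).aestronglyMeasurable
      · filter_upwards [hn3] with n hn
        exact .of_forall fun ω => abs_two_mul_statF_div_le _ hn
    have h := IsJet.of_mul_eq hb h2F jD (by positivity) hK (by
      filter_upwards [hn3] with n hn
      exact .of_forall fun ω => two_mul_statF_div_mul _ hn)
    convert h using 1
    · ext i
      fin_cases i <;> simp [coefOne] <;> field_simp <;> ring
    · rw [hform]
      simp only [coefOne, coefZero, Matrix.cons_val]
      field_simp
      ring
  have jKH := (jK.mul hb jH).const_mul 2
  have jKKG := (jK.mul hb (jK.mul hb jG)).const_mul 2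
  have jV := (jC.sub hb jKH).add hb jKKG
  have jU := jC.sub hb (jE.const_mul 2)
  have jY : IsJet P (basis v z a) (fun n ω => 1 - burgPhi2 n (fun t => z t ω))
      (1 - φ₂) ![ρ / (g * (1 - ρ ^ 2)), -1 / (g * (1 - ρ ^ 2)), 0] (1 + 3 * φ₂) := by
    rw [show 2 * g - 2 * ((ρ ^ 2 * (1 - φ₂) + φ₂) * g) =
      (1 - φ₂) * (2 * g - 2 * (ρ * (2 * (ρ * g))) + 2 * (ρ * (ρ * g))) by ring] at jU
    have hd : 2 * g - 2 * (ρ * (2 * (ρ * g))) + 2 * (ρ * (ρ * g)) = 2 * (g * (1 - ρ ^ 2)) := by ring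
    have hd0 : 2 * (g * (1 - ρ ^ 2)) ≠ 0 := mul_ne_zero two_ne_zero (mul_ne_zero hg.ne' hρ3)
    have hY : MomentO P (fun n ω => 1 - burgPhi2 n (fun t => z t ω)) 0 := by
      refine MomentO.of_abs_le (C := 2) ?_ ?_
      · filter_upwards [mF, mD, (jC.momentO hb).eventually_aestronglyMeasurable,
          (jE.momentO hb).eventually_aestronglyMeasurable,
          (jG.momentO hb).eventually_aestronglyMeasurable,
          (jH.momentO hb).eventually_aestronglyMeasurable] with n hF hD hC hE hG hH
        have aF := hF.aemeasurable
        have aD := hD.aemeasurable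
        have aC := hC.aemeasurable
        have aE := hE.aemeasurable
        have aG := hG.aemeasurable
        have aH := hH.aemeasurable
        refine AEMeasurable.aestronglyMeasurable ?_
        simp only [burgPhi2]
        fun_prop
      · filter_upwards [hn3] with n hn
        exact .of_forall fun ω => abs_one_sub_burgPhi2_le _ hn
    have h := IsJet.of_mul_eq hb jU jV (by rw [hd]; exact hd0) hY (by
      filter_upwards [hn3] with n hn
      exact .of_forall fun ω => one_sub_burgPhi2_mul _ hn)
    rw [hd] at h
    convert h using 1
    · ext i
      fin_cases i <;> simp [coefOne, coefTwo] <;> field_simp <;> ring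
    · simp only [hform, coefOne, coefTwo, coefZero, Matrix.cons_val]
      field_simp
      ring
  constructor
  · have h := jK.mul hb jY
    rw [← hφ] at h
    convert h.hasBiasToOrderInv hb using 1
    · rfl
    · rw [hform, hφ]
      simp only [Matrix.cons_val]
      field_simp
      ring
  · have h := (IsJet.const (P := P) (m := basis v z a) 1).sub hb jY
    simp only [sub_sub_cancel, zero_sub] at h
    exact h.hasBiasToOrderInv hb

omit [MeasurableSpace Ω] in
theorem gram_avgProd_eq (n : ℕ) (ω : Ω) : avgProd z 2 2 n ω * avgProd z 1 1 n ω -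
    avgProd z 2 1 n ω * avgProd z 2 1 n ω = (1 / ((n : ℝ) - 2)) ^ 2 * gramDet z n ω := by
  simp only [avgProd, gramDet, ← sq]
  ring

/-- Undoing the normalisation costs (n − 2)². This crude polynomial growth is all that
`IsJet.of_mul_eq` requires. -/
theorem momentO_inv_gram (ha : ∀ t, Measurable (a t))
    (hz : IsStationaryGaussianAR2 P φ₁ φ₂ v z a)
    (hp : ∀ t, AEStronglyMeasurable[pastSigma a t] (z t) P) :
    MomentO P (fun n ω => (avgProd z 2 2 n ω * avgProd z 1 1 n ω -
      avgProd z 2 1 n ω * avgProd z 2 1 n ω)⁻¹) (0 + 2) := by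
  refine ((hz.momentO_inv_gramDet ha hp).seq_mul (c := fun n => ((n : ℝ) - 2) ^ 2) (K := 1)
    (s := 2) ?_).congr ?_
  · filter_upwards [eventually_ge_atTop 3] with n hn
    have h3 : (3 : ℝ) ≤ n := by exact_mod_cast hn
    rw [abs_of_nonneg (sq_nonneg _), one_mul, Real.rpow_two]
    nlinarith
  · refine .of_forall fun n => .of_forall fun ω => ?_
    simp only
    rw [gram_avgProd_eq, mul_inv]
    simp

theorem eventually_ae_gram_ne_zero (ha : ∀ t, Measurable (a t))
    (hz : IsStationaryGaussianAR2 P φ₁ φ₂ v z a)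
    (hp : ∀ t, AEStronglyMeasurable[pastSigma a t] (z t) P) :
    ∀ᶠ n : ℕ in atTop, ∀ᵐ ω ∂P, avgProd z 2 2 n ω * avgProd z 1 1 n ω -
      avgProd z 2 1 n ω * avgProd z 2 1 n ω ≠ 0 := by
  filter_upwards [eventually_ge_atTop 5] with n hn
  filter_upwards [hz.ae_gramDet_ne_zero ha hp hn] with ω hω
  have h3 : (5 : ℝ) ≤ n := by exact_mod_cast hn
  rw [gram_avgProd_eq]
  exact mul_ne_zero (pow_ne_zero 2 (one_div_ne_zero (by linarith))) hω

omit [IsProbabilityMeasure P] in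
-- The normal equations minus the first two sample Yule–Walker equations: the estimation error
-- solves a 2 × 2 system with the scores on the right.
theorem eventually_ae_normal_equations (hz : IsStationaryGaussianAR2 P φ₁ φ₂ v z a)
    {b₁ b₂ : ℕ → Ω → ℝ} (hb12 : ∀ᶠ n in atTop, ∀ᵐ ω ∂P,
      IsLeastSquaresAR2 n (fun t => z t ω) (b₁ n ω) (b₂ n ω)) :
    ∀ᶠ n : ℕ in atTop, ∀ᵐ ω ∂P,
      avgProd z 2 2 n ω * (b₁ n ω - φ₁) + avgProd z 2 1 n ω * (b₂ n ω - φ₂) = basis v z a 0 n ω ∧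
      avgProd z 2 1 n ω * (b₁ n ω - φ₁) + avgProd z 1 1 n ω * (b₂ n ω - φ₂) =
        basis v z a 1 n ω := by
  filter_upwards [hb12, eventually_ge_atTop 3] with n hn hn3
  filter_upwards [hn, hz.sample_yule_walker hn3] with ω hω hyw
  obtain ⟨w1, w2, -⟩ := hyw
  obtain ⟨n1, n2⟩ := hω.normal_equations
  rw [sum_Icc_eq_sum_range _ 3 (n - 2) (by omega)] at n1 n2
  have s1 : ∀ i : ℤ, i + 3 - 1 = i + 2 := fun i => by ring
  have s2 : ∀ i : ℤ, i + 3 - 2 = i + 1 := fun i => by ring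
  simp only [s1, s2] at n1 n2
  have m1 : avgProd z 3 2 n ω - b₁ n ω * avgProd z 2 2 n ω - b₂ n ω * avgProd z 2 1 n ω = 0 := by
    rw [← mul_zero (1 / ((n : ℝ) - 2)), ← n1]
    simp only [avgProd, Finset.mul_sum, ← Finset.sum_sub_distrib]
    exact Finset.sum_congr rfl fun i _ => by ring
  have m2 : avgProd z 3 1 n ω - b₁ n ω * avgProd z 2 1 n ω - b₂ n ω * avgProd z 1 1 n ω = 0 := by
    rw [← mul_zero (1 / ((n : ℝ) - 2)), ← n2]
    simp only [avgProd, Finset.mul_sum, ← Finset.sum_sub_distrib]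
    exact Finset.sum_congr rfl fun i _ => by ring
  constructor
  · linear_combination w1 - m1
  · linear_combination w2 - m2

set_option maxHeartbeats 1000000 in
-- Cramer's rule writes each error as a quotient of jets over the Gram determinant. Its limit is 0,
-- so the bias of the determinant is irrelevant; what counts is the mean of the numerator and the
-- covariance of the error with the determinant.
theorem leastSquares_hasBias (h1 : |φ₂| < 1) (h2 : φ₁ + φ₂ < 1) (h3 : φ₂ - φ₁ < 1)
    (ha : ∀ t, Measurable (a t)) (hz : IsStationaryGaussianAR2 P φ₁ φ₂ v z a)
    {b₁ b₂ : ℕ → Ω → ℝ} (hb12 : ∀ᶠ n in atTop, ∀ᵐ ω ∂P,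
      IsLeastSquaresAR2 n (fun t => z t ω) (b₁ n ω) (b₂ n ω)) :
    HasBiasToOrderInv P b₁ φ₁ (-φ₁) ∧ HasBiasToOrderInv P b₂ φ₂ (-(1 + 3 * φ₂)) := by
  obtain ⟨hp, hm⟩ := hz.past_and_moments h1 h2 h3 ha
  have hb := hz.isJetBasis ha hp hm
  obtain ⟨-, j22, j11, -, j21, -⟩ := hz.isJet_avgProd h1 h2 h3 ha hp hm
  have jW0 := hz.isJet_basis ha hp hm 0
  have jW1 := hz.isJet_basis ha hp hm 1
  have hg := hz.acov_zero_pos h2 h3 ha hp hm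
  obtain ⟨hf1, hf2, hφ, hρ3, hf3, e1, e2, hv⟩ := hz.acov_parametrization h1 h2 h3 ha hp hm
  set ρ := φ₁ / (1 - φ₂) with hρ
  generalize (∫ x, (x ^ 2 - (v : ℝ)) ^ 2 ∂gaussianReal 0 v) = τ at hb
  have hform : ∀ l k : Fin 3 → ℝ, jetForm (basisCov v (acov P z 0) (acov P z 1) τ) l k =
      acov P z 0 ^ 2 * ((1 - φ₂ ^ 2) * (1 - ρ ^ 2)) * (l 0 * k 0 + l 1 * k 1 +
        ρ * (l 0 * k 1 + l 1 * k 0)) + τ * (l 2 * k 2) := by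
    intro l k
    simp only [jetForm, basisCov, Fin.sum_univ_three, Matrix.cons_val, hv, e1]
    ring
  rw [e1] at j21
  set g := acov P z 0 with hgdef
  generalize hS : basisCov v g (acov P z 1) τ = S at hb hform
  have jV := (j22.mul hb j11).sub hb (j21.mul hb j21)
  have hd : g * g - ρ * g * (ρ * g) = g ^ 2 * (1 - ρ ^ 2) := by ring
  have hd0 : g ^ 2 * (1 - ρ ^ 2) ≠ 0 := mul_ne_zero (pow_ne_zero 2 hg.ne') hρ3
  rw [hd] at jV
  have hinv := hz.momentO_inv_gram ha hp
  have hV0 := hz.eventually_ae_gram_ne_zero ha hp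
  have hnormal := hz.eventually_ae_normal_equations hb12
  -- No measurability of the minimizers is assumed: it follows, with the crude moment bound, from
  -- almost sure equality with U divided by the determinant.
  have main : ∀ {X U : ℕ → Ω → ℝ} {l : Fin 3 → ℝ} {q : ℝ}, IsJet P (basis v z a) U 0 l q →
      (∀ᶠ n : ℕ in atTop, ∀ᵐ ω ∂P, X n ω * (avgProd z 2 2 n ω * avgProd z 1 1 n ω -
        avgProd z 2 1 n ω * avgProd z 2 1 n ω) = U n ω) → MomentO P X 2 := by
    intro X U l q hU hX
    refine ((hinv.mul (hU.momentO hb)).mono (by norm_num : (0 + 2 + 0 : ℝ) ≤ 2)).congr ?_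
    filter_upwards [hX, hV0] with n hn h0
    filter_upwards [hn, h0] with ω hω hω0
    rw [← hω, mul_comm (X n ω), inv_mul_cancel_left₀ hω0]
  have jU1 := (j11.mul hb jW0).sub hb (j21.mul hb jW1)
  have jU2 := (j22.mul hb jW1).sub hb (j21.mul hb jW0)
  simp only [mul_zero, sub_zero] at jU1 jU2
  have hX1 : ∀ᶠ n : ℕ in atTop, ∀ᵐ ω ∂P, (b₁ n ω - φ₁) * (avgProd z 2 2 n ω * avgProd z 1 1 n ω -
      avgProd z 2 1 n ω * avgProd z 2 1 n ω) =
      avgProd z 1 1 n ω * basis v z a 0 n ω - avgProd z 2 1 n ω * basis v z a 1 n ω := by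
    filter_upwards [hnormal] with n hn
    filter_upwards [hn] with ω hω
    rw [← hω.1, ← hω.2]
    ring
  have hX2 : ∀ᶠ n : ℕ in atTop, ∀ᵐ ω ∂P, (b₂ n ω - φ₂) * (avgProd z 2 2 n ω * avgProd z 1 1 n ω -
      avgProd z 2 1 n ω * avgProd z 2 1 n ω) =
      avgProd z 2 2 n ω * basis v z a 1 n ω - avgProd z 2 1 n ω * basis v z a 0 n ω := by
    filter_upwards [hnormal] with n hn
    filter_upwards [hn] with ω hω
    rw [← hω.1, ← hω.2]
    ring
  have hM1 := main jU1 hX1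
  have hM2 := main jU2 hX2
  have hc : (0 : ℝ) = 0 * (g ^ 2 * (1 - ρ ^ 2)) := (zero_mul _).symm
  have k1 := (IsJet.of_mul_eq hb (jU1.of_eq hc) jV hd0 hM1 hX1).add hb
    (IsJet.const (P := P) (m := basis v z a) φ₁)
  have k2 := (IsJet.of_mul_eq hb (jU2.of_eq hc) jV hd0 hM2 hX2).add hb
    (IsJet.const (P := P) (m := basis v z a) φ₂)
  simp only [zero_add, sub_add_cancel] at k1 k2
  constructor
  · convert k1.hasBiasToOrderInv hb using 1
    rw [hφ]
    simp only [hform, coefOne, coefZero, Matrix.cons_val]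
    simp
    field_simp
    ring
  · convert k2.hasBiasToOrderInv hb using 1
    simp only [hform, coefOne, coefZero, Matrix.cons_val]
    simp
    field_simp
    ring

end IsStationaryGaussianAR2

end

theorem mainTheorem1 {Ω : Type*} [MeasurableSpace Ω] (P : Measure Ω) [IsProbabilityMeasure P]
    (φ₁ φ₂ : ℝ) (hφ₂ : |φ₂| < 1) (hsum : φ₁ + φ₂ < 1) (hdiff : φ₂ - φ₁ < 1)
    (v : ℝ≥0) (z a : ℤ → Ω → ℝ) (hz : IsStationaryGaussianAR2 P φ₁ φ₂ v z a) :
    (HasBiasToOrderInv P (fun n ω => burgPhi1 n (fun t => z t ω)) φ₁ (-φ₁) ∧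
      HasBiasToOrderInv P (fun n ω => burgPhi2 n (fun t => z t ω)) φ₂ (-(1 + 3 * φ₂))) ∧
    ∀ b₁ b₂ : ℕ → Ω → ℝ,
      (∀ᶠ n in atTop, ∀ᵐ ω ∂P,
        IsLeastSquaresAR2 n (fun t => z t ω) (b₁ n ω) (b₂ n ω)) →
      HasBiasToOrderInv P b₁ φ₁ (-φ₁) ∧ HasBiasToOrderInv P b₂ φ₂ (-(1 + 3 * φ₂)) := by
  -- The innovations are only almost everywhere measurable; measurable versions make the past
  -- σ-algebras sub-σ-algebras of the given one.
  obtain ⟨b, hb, hzb⟩ := hz.exists_measurable_innovation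
  exact ⟨hzb.burg_hasBias hφ₂ hsum hdiff hb, fun b₁ b₂ h =>
    hzb.leastSquares_hasBias hφ₂ hsum hdiff hb h⟩
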